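/- An instance of unrelated-machine Makespan consists of a nonempty finite set $M$ of machines, a finite set $J$ of jobs and sizes $p_{ij}\in\mathbb{Q}_{\ge 0}$ ($i\in M$, $j\in J$); the task is to find an assignment $\sigma:J\to M$ that minimizes the makespan $\max_{i\in M}\sum_{j:\sigma(j)=i}p_{ij}$. An instance of Santa Claus (max-min fair allocation) consists of a nonempty finite set $P$ of players, a finite set $R$ of resources and values $v_{ij}\in\mathbb{Q}_{\ge 0}$ ($i\in P$, $j\in R$); the task is to find an assignment $\sigma:R\to P$ that maximizes the minimum value $\min_{i\in P}\sum_{j:\sigma(j)=i}v_{ij}$. Numbers are given in binary, as numerator and denominator. For $\rho\ge 1$, a polynomial-time $\rho$-approximation is a deterministic algorithm that, on every instance with optimum $\mathrm{OPT}$, outputs in time polynomial in the encoding length of the instance an assignment of makespan at most $\rho\cdot\mathrm{OPT}$ (for Makespan), respectively of minimum value at least $\mathrm{OPT}/\rho$ (for Santa Claus). Theorem. Let $\alpha\ge 2$ be a real number. If there exists a polynomial-time $(2-1/\alpha)$-approximation for Makespan, then for every $\epsilon>0$ there exists a polynomial-time $(\alpha+\epsilon)$-approximation for Santa Claus. -/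

import Mathlib

/-! ## A machine model with a step count

Programs compute on finite binary trees (as in pure first-order LISP, or the WHILE language of
Jones).  Every elementary operation is charged the full size of the data that it reads or copies
(no sharing, no unit-cost arithmetic), so that "polynomially many steps" is the usual notion of
polynomial time: such programs and multitape Turing machines simulate each other with polynomial
overhead. -/

/-- Binary trees, the data on which programs compute. -/
inductive BinTree : Type
  | nil : BinTree
  | cons : BinTree → BinTree → BinTree

namespace BinTree

/-- The number of nodes (including the empty leaves) of a tree. -/
def size : BinTree → ℕ
  | nil => 1
  | cons a b => a.size + b.size + 1

/-- Left subtree (`nil` for the empty tree). -/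
def head : BinTree → BinTree
  | nil => nil
  | cons a _ => a

/-- Right subtree (`nil` for the empty tree). -/
def tail : BinTree → BinTree
  | nil => nil
  | cons _ b => b

/-- A list of trees as a right comb. -/
def ofList : List BinTree → BinTree
  | [] => nil
  | a :: l => cons a (ofList l)

/-- A bit. -/
def ofBool : Bool → BinTree
  | false => nil
  | true => cons nil nil

/-- A natural number, written in binary (least significant bit first). -/
def ofNat (n : ℕ) : BinTree := ofList (n.bits.map ofBool)

/-- A nonnegative rational, as numerator and denominator in lowest terms, both in binary. -/
def ofNNRat (q : ℚ≥0) : BinTree := cons (ofNat q.num) (ofNat q.den)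

end BinTree

/-- Programs. Each maps one tree to one tree. -/
inductive TreeProgram : Type
  /-- return the input -/
  | id : TreeProgram
  /-- return the empty tree -/
  | nil : TreeProgram
  /-- return the left subtree of the input -/
  | head : TreeProgram
  /-- return the right subtree of the input -/
  | tail : TreeProgram
  /-- run both programs on the input and join the two results -/
  | cons : TreeProgram → TreeProgram → TreeProgram
  /-- run the first program on the input, then the second one on the result -/
  | comp : TreeProgram → TreeProgram → TreeProgram
  /-- run the first program (the test) on the input; if its result is not `nil`, run the second
  program on the input, otherwise the third -/
  | ite : TreeProgram → TreeProgram → TreeProgram → TreeProgram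
  /-- as long as the left subtree of the current tree is not `nil`, replace the current tree by
  the result of the program on it -/
  | loop : TreeProgram → TreeProgram

namespace TreeProgram

/-- `Runs p x y t`: on input `x`, the program `p` halts with output `y` after `t` steps. -/
inductive Runs : TreeProgram → BinTree → BinTree → ℕ → Prop
  | id (x : BinTree) : Runs .id x x x.size
  | nil (x : BinTree) : Runs .nil x .nil x.size
  | head (x : BinTree) : Runs .head x x.head x.size
  | tail (x : BinTree) : Runs .tail x x.tail x.size
  | cons {p q : TreeProgram} {x a b : BinTree} {s t : ℕ} :
      Runs p x a s → Runs q x b t → Runs (.cons p q) x (.cons a b) (s + t + x.size)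
  | comp {p q : TreeProgram} {x y z : BinTree} {s t : ℕ} :
      Runs p x y s → Runs q y z t → Runs (.comp p q) x z (s + t)
  | iteTrue {c p q : TreeProgram} {x b y : BinTree} {s t : ℕ} :
      Runs c x b s → b ≠ .nil → Runs p x y t → Runs (.ite c p q) x y (s + t + x.size)
  | iteFalse {c p q : TreeProgram} {x y : BinTree} {s t : ℕ} :
      Runs c x .nil s → Runs q x y t → Runs (.ite c p q) x y (s + t + x.size)
  | loopStop {p : TreeProgram} {x : BinTree} :
      x.head = .nil → Runs (.loop p) x x x.size
  | loopStep {p : TreeProgram} {x y z : BinTree} {s t : ℕ} :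
      x.head ≠ .nil → Runs p x y s → Runs (.loop p) y z t →
        Runs (.loop p) x z (s + t + x.size)

end TreeProgram

/-! ## Makespan and Santa Claus -/

/-- The common input of the two problems: a nonempty set of `m` agents (machines, players),
a set of `n` items (jobs, resources), and for each agent `i` and item `j` a nonnegative rational
number `w i j` (the size of job `j` on machine `i`, the value of resource `j` for player `i`). -/
structure AllocInstance where
  m : ℕ
  n : ℕ
  m_pos : 0 < m
  w : Fin m → Fin n → ℚ≥0

namespace AllocInstance

/-- An assignment gives every item to exactly one agent. -/
abbrev Assignment (I : AllocInstance) : Type := Fin I.n → Fin I.m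

instance (I : AllocInstance) : Nonempty (Fin I.m) := ⟨⟨0, I.m_pos⟩⟩

/-- The total size (value) of the items that `σ` assigns to the agent `i`. -/
def load (I : AllocInstance) (σ : I.Assignment) (i : Fin I.m) : ℚ≥0 :=
  ∑ j with σ j = i, I.w i j

/-- The maximum load of a machine. -/
def makespan (I : AllocInstance) (σ : I.Assignment) : ℚ≥0 :=
  Finset.univ.sup' Finset.univ_nonempty (I.load σ)

/-- The minimum total value that a player receives. -/
def minValue (I : AllocInstance) (σ : I.Assignment) : ℚ≥0 :=
  Finset.univ.inf' Finset.univ_nonempty (I.load σ)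

/-- The optimum of the instance, read as an instance of Makespan. -/
def optMakespan (I : AllocInstance) : ℚ≥0 :=
  Finset.univ.inf' Finset.univ_nonempty I.makespan

/-- The optimum of the instance, read as an instance of Santa Claus. -/
def optSantaClaus (I : AllocInstance) : ℚ≥0 :=
  Finset.univ.sup' Finset.univ_nonempty I.minValue

/-- An instance is given to a program as the list of the rows of `w`. -/
def encode (I : AllocInstance) : BinTree :=
  .ofList (List.ofFn fun i => .ofList (List.ofFn fun j => .ofNNRat (I.w i j)))

/-- A program returns an assignment as the list of the (numbers of the) agents that receive the
items `0, 1, …, n - 1`. -/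
def encodeAssignment (I : AllocInstance) (σ : I.Assignment) : BinTree :=
  .ofList (List.ofFn fun j => .ofNat (σ j : ℕ))

end AllocInstance

namespace TreeProgram

/-- On every instance, the program `p` halts, within a number of steps that is bounded by a
polynomial in the size of the encoded instance, and returns an assignment with the property
`good`. -/
def FindsInPolyTime (p : TreeProgram) (good : (I : AllocInstance) → I.Assignment → Prop) : Prop :=
  ∃ P : Polynomial ℕ, ∀ I : AllocInstance, ∃ (σ : I.Assignment) (t : ℕ),
    p.Runs I.encode (I.encodeAssignment σ) t ∧ t ≤ P.eval I.encode.size ∧ good I σ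

end TreeProgram

/-- `p` is a polynomial-time `ρ`-approximation for Makespan. -/
def IsPolyTimeMakespanApprox (ρ : ℝ) (p : TreeProgram) : Prop :=
  p.FindsInPolyTime fun I σ => (I.makespan σ : ℝ) ≤ ρ * (I.optMakespan : ℝ)

/-- `p` is a polynomial-time `ρ`-approximation for Santa Claus. -/
def IsPolyTimeSantaClausApprox (ρ : ℝ) (p : TreeProgram) : Prop :=
  p.FindsInPolyTime fun I σ => (I.optSantaClaus : ℝ) / ρ ≤ (I.minValue σ : ℝ)

open Polynomial

/-! ## Polynomial-time functions between encoded types -/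

/-! Fix a large integer `q` and guess a target value `T` slightly below the Santa Claus optimum.
Scale `T` to an integer `N` (`scaledTarget`). A configuration is a multiset of integers with sum
between `(1 - 3/q) N` and `N`. The Makespan instance has a machine for each resource and a machine,
called a slot, for each pair of a player and a configuration. Every player has a selector job of
size `N` on each slot of that player. Every entry `θ` of the configuration of a slot is a job of
size `θ` on that slot and of size `N` on each resource worth at least `θ T / N` to the player. A
selector is treated on resources as an entry `N`. All other sizes are `2 N`.

Completeness (`optMakespan_reduction_le`): if every player can obtain `T`, each has a configuration
whose entries can be matched injectively to resources received. Put the selector on that slot, the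
entries of that configuration on the matched resources, and all other entries on their own slots.
Every load is at most `N`.

Soundness (`reduction_sound`): a makespan of at most `(2 - 1/α) N < 2 N` excludes sizes `2 N` and
leaves at most one job on each resource. A selector on a slot leaves room for entries of total at
most `(1 - 1/α) N`. Hence entries of total at least `(1/α - 3/q) N` have moved to resources, and the
player obtains value at least `(1/α - 3/q) T` from them. A selector on a resource means that this
resource alone is worth `T`.

The reduction is polynomial because there are few configurations. With `u` the bit length of the
number `n` of resources, values are rounded down to `m * 2 ^ e` with `1 ≤ m ≤ 2 q`, and equal
rounded values are used only in bundles of total at least `2 ^ u`. Since `N / 2 ^ u = O(log n)` for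
fixed `q`, a configuration has `O(log n)` bundles from `O(log n)` classes. It is found by `O(log n)`
binary decisions, so there are polynomially many. By `exists_config`, this loses only a fraction
`3/q` of the value.

All guesses are tried and the best resulting assignment is returned. `exists_guess` provides a guess
within the factor `(q + 1) / q` of the optimum. The running time is handled by a calculus of
functions computable in polynomial time, whose only recursion principle is the fold over a list with
intermediate results of polynomial size (`PolyTime.foldl`). -/

/-- A representation of the elements of a type by trees. -/
class TreeEncoding (X : Type) where
  enc : X → BinTree

namespace TreeEncoding

instance : TreeEncoding Unit := ⟨fun _ => .nil⟩
instance : TreeEncoding Bool := ⟨.ofBool⟩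
instance : TreeEncoding ℕ := ⟨.ofNat⟩
instance {X Y : Type} [TreeEncoding X] [TreeEncoding Y] : TreeEncoding (X × Y) :=
  ⟨fun x => .cons (enc x.1) (enc x.2)⟩
instance {X : Type} [TreeEncoding X] : TreeEncoding (List X) := ⟨fun l => .ofList (l.map enc)⟩
instance : TreeEncoding AllocInstance := ⟨AllocInstance.encode⟩

/-- The size of the tree that represents `x`. -/
def esize {X : Type} [TreeEncoding X] (x : X) : ℕ := (enc x).size

end TreeEncoding

open TreeEncoding

theorem Polynomial.eval_mono_nat (P : ℕ[X]) {a b : ℕ} (h : a ≤ b) : P.eval a ≤ P.eval b := by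
  rw [eval_eq_sum, eval_eq_sum]
  exact Finset.sum_le_sum fun i _ => Nat.mul_le_mul_left _ (Nat.pow_le_pow_left h i)

namespace BinTree

theorem size_pos (x : BinTree) : 0 < x.size := by cases x <;> simp [size]

theorem size_head_le (x : BinTree) : x.head.size ≤ x.size := by
  cases x <;> simp [size, head]; omega

theorem size_tail_le (x : BinTree) : x.tail.size ≤ x.size := by
  cases x <;> simp [size, tail]; omega

end BinTree

/-- Each operation is charged for the data it reads or copies, so no output can be larger than the
time spent. This makes polynomial time closed under composition. -/
theorem TreeProgram.Runs.size_le {p : TreeProgram} {x y : BinTree} {t : ℕ} (h : p.Runs x y t) :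
    y.size ≤ t := by
  induction h with
  | id x => exact le_rfl
  | nil x => exact x.size_pos
  | head x => exact x.size_head_le
  | tail x => exact x.size_tail_le
  | @cons p q x a b s t _ _ h1 h2 => have := x.size_pos; simp only [BinTree.size]; omega
  | comp _ _ h1 h2 => omega
  | iteTrue _ _ _ h1 h2 => omega
  | iteFalse _ _ h1 h2 => omega
  | loopStop _ => exact le_rfl
  | loopStep _ _ _ h1 h2 => omega

section
variable {X Y Z A B : Type} [TreeEncoding X] [TreeEncoding Y] [TreeEncoding Z] [TreeEncoding A]
  [TreeEncoding B]

theorem TreeEncoding.esize_pos (x : X) : 0 < esize x := BinTree.size_pos _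

@[simp] theorem TreeEncoding.esize_prod (x : X × Y) : esize x = esize x.1 + esize x.2 + 1 := rfl

@[simp] theorem TreeEncoding.enc_nil : enc ([] : List X) = .nil := rfl

@[simp] theorem TreeEncoding.enc_cons (a : X) (l : List X) :
    enc (a :: l) = .cons (enc a) (enc l) := rfl

@[simp] theorem TreeEncoding.esize_nil : esize ([] : List X) = 1 := rfl

@[simp] theorem TreeEncoding.esize_cons (a : X) (l : List X) :
    esize (a :: l) = esize a + esize l + 1 := rfl

/-- A function with values in `ℕ` that is bounded by a polynomial in the size of its argument. -/
def PolySize (f : X → ℕ) : Prop := ∃ P : ℕ[X], ∀ x, f x ≤ P.eval (esize x)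

/-- A function between encoded types that a program computes in polynomial time. -/
@[fun_prop]
def PolyTime (f : X → Y) : Prop :=
  ∃ (p : TreeProgram) (P : ℕ[X]), ∀ x, ∃ t, p.Runs (enc x) (enc (f x)) t ∧ t ≤ P.eval (esize x)

namespace PolySize

theorem mono {f g : X → ℕ} (hg : PolySize g) (h : ∀ x, f x ≤ g x) : PolySize f := by
  obtain ⟨P, hP⟩ := hg
  exact ⟨P, fun x => (h x).trans (hP x)⟩

theorem const (c : ℕ) : PolySize (fun _ : X => c) := ⟨C c, fun x => by simp⟩

theorem self : PolySize (fun x : X => esize x) := ⟨.X, fun x => by simp⟩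

theorem add {f g : X → ℕ} (hf : PolySize f) (hg : PolySize g) : PolySize fun x => f x + g x := by
  obtain ⟨P, hP⟩ := hf
  obtain ⟨Q, hQ⟩ := hg
  exact ⟨P + Q, fun x => by rw [eval_add]; exact add_le_add (hP x) (hQ x)⟩

theorem mul {f g : X → ℕ} (hf : PolySize f) (hg : PolySize g) : PolySize fun x => f x * g x := by
  obtain ⟨P, hP⟩ := hf
  obtain ⟨Q, hQ⟩ := hg
  exact ⟨P * Q, fun x => by rw [eval_mul]; exact Nat.mul_le_mul (hP x) (hQ x)⟩

theorem pow {f : X → ℕ} (hf : PolySize f) (k : ℕ) : PolySize fun x => f x ^ k := by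
  obtain ⟨P, hP⟩ := hf
  exact ⟨P ^ k, fun x => by rw [eval_pow]; exact Nat.pow_le_pow_left (hP x) k⟩

theorem comp_le {f : Y → ℕ} (hf : PolySize f) {g : X → Y} {b : X → ℕ} (hb : PolySize b)
    (h : ∀ x, esize (g x) ≤ b x) : PolySize fun x => f (g x) := by
  obtain ⟨P, hP⟩ := hf
  obtain ⟨Q, hQ⟩ := hb
  refine ⟨P.comp Q, fun x => (hP _).trans ?_⟩
  rw [eval_comp]
  exact P.eval_mono_nat ((h x).trans (hQ x))

end PolySize

namespace PolyTime

theorem polySize {f : X → Y} (hf : PolyTime f) : PolySize fun x => esize (f x) := by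
  obtain ⟨p, P, h⟩ := hf
  refine ⟨P, fun x => ?_⟩
  obtain ⟨t, h1, h2⟩ := h x
  exact h1.size_le.trans h2

theorem of_polySize {f : X → Y} (p : TreeProgram) {b : X → ℕ} (hb : PolySize b)
    (h : ∀ x, ∃ t, p.Runs (enc x) (enc (f x)) t ∧ t ≤ b x) : PolyTime f := by
  obtain ⟨P, hP⟩ := hb
  refine ⟨p, P, fun x => ?_⟩
  obtain ⟨t, h1, h2⟩ := h x
  exact ⟨t, h1, h2.trans (hP x)⟩

theorem exists_runs {f : X → Y} (hf : PolyTime f) : ∃ (p : TreeProgram) (b : X → ℕ),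
    PolySize b ∧ ∀ x, ∃ t, p.Runs (enc x) (enc (f x)) t ∧ t ≤ b x := by
  obtain ⟨p, P, h⟩ := hf
  exact ⟨p, fun x => P.eval (esize x), ⟨P, fun _ => le_rfl⟩, h⟩

/-- Programs see only trees. This permits a change of type without computation: a number is its list
of bits, an instance is its matrix of fractions. -/
theorem congr_enc {f : X → Y} {g : X → Z} (hf : PolyTime f) (h : ∀ x, enc (f x) = enc (g x)) :
    PolyTime g := by
  obtain ⟨p, P, hP⟩ := hf
  exact ⟨p, P, fun x => h x ▸ hP x⟩

theorem of_enc_eq {f : X → Y} (h : ∀ x, enc (f x) = enc x) : PolyTime f :=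
  of_polySize .id .self fun x => ⟨_, by rw [h x]; exact .id _, le_rfl⟩

@[fun_prop]
theorem id : PolyTime (fun x : X => x) := of_enc_eq fun _ => rfl

theorem exists_const_program (c : BinTree) :
    ∃ (p : TreeProgram) (k : ℕ), ∀ x : BinTree, p.Runs x c (k * x.size) := by
  induction c with
  | nil => exact ⟨.nil, 1, fun x => by simpa using .nil x⟩
  | cons a b ha hb =>
    obtain ⟨p, k, hp⟩ := ha
    obtain ⟨q, l, hq⟩ := hb
    refine ⟨.cons p q, k + l + 1, fun x => ?_⟩
    simpa [add_mul] using TreeProgram.Runs.cons (hp x) (hq x)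

@[fun_prop]
theorem const (c : Y) : PolyTime (fun _ : X => c) := by
  obtain ⟨p, k, hp⟩ := exists_const_program (enc c)
  exact of_polySize p ((PolySize.const k).mul .self) fun x => ⟨_, hp _, le_rfl⟩

@[fun_prop]
theorem comp {g : Y → Z} {f : X → Y} (hg : PolyTime g) (hf : PolyTime f) :
    PolyTime fun x => g (f x) := by
  have hs := hf.polySize
  obtain ⟨p, b, hb, hp⟩ := hf.exists_runs
  obtain ⟨q, c, hc, hq⟩ := hg.exists_runs
  refine of_polySize (.comp p q) (hb.add (hc.comp_le hs fun _ => le_rfl)) fun x => ?_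
  obtain ⟨s, h1, h2⟩ := hp x
  obtain ⟨t, h3, h4⟩ := hq (f x)
  exact ⟨_, .comp h1 h3, add_le_add h2 h4⟩

@[fun_prop]
theorem pair {f : X → Y} {g : X → Z} (hf : PolyTime f) (hg : PolyTime g) :
    PolyTime fun x => (f x, g x) := by
  obtain ⟨p, b, hb, hp⟩ := hf.exists_runs
  obtain ⟨q, c, hc, hq⟩ := hg.exists_runs
  refine of_polySize (.cons p q) ((hb.add hc).add .self) fun x => ?_
  obtain ⟨s, h1, h2⟩ := hp x
  obtain ⟨t, h3, h4⟩ := hq x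
  exact ⟨_, .cons h1 h3, add_le_add (add_le_add h2 h4) le_rfl⟩

@[fun_prop]
theorem fst {f : X → Y × Z} (hf : PolyTime f) : PolyTime fun x => (f x).1 :=
  comp (g := fun y : Y × Z => y.1)
    (of_polySize .head .self fun x => ⟨_, .head (enc x), le_rfl⟩) hf

@[fun_prop]
theorem snd {f : X → Y × Z} (hf : PolyTime f) : PolyTime fun x => (f x).2 :=
  comp (g := fun y : Y × Z => y.2)
    (of_polySize .tail .self fun x => ⟨_, .tail (enc x), le_rfl⟩) hf

@[fun_prop]
theorem cond {c : X → Bool} {f g : X → Y} (hc : PolyTime c) (hf : PolyTime f) (hg : PolyTime g) :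
    PolyTime fun x => bif c x then f x else g x := by
  obtain ⟨r, d, hd, hr⟩ := hc.exists_runs
  obtain ⟨p, b, hb, hp⟩ := hf.exists_runs
  obtain ⟨q, e, he, hq⟩ := hg.exists_runs
  refine of_polySize (.ite r p q) ((hd.add (hb.add he)).add .self) fun x => ?_
  obtain ⟨s, h1, h2⟩ := hr x
  cases h : c x with
  | true =>
    obtain ⟨t, h3, h4⟩ := hp x
    refine ⟨_, .iteTrue h1 ?_ h3, ?_⟩
    · rw [h]; exact BinTree.noConfusion
    · change s + t + esize x ≤ _; omega
  | false =>
    obtain ⟨t, h3, h4⟩ := hq x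
    rw [h] at h1
    exact ⟨_, .iteFalse h1 h3, by change s + t + esize x ≤ _; omega⟩

theorem ite {c : X → Prop} [DecidablePred c] {f g : X → Y} (hc : PolyTime fun x => decide (c x))
    (hf : PolyTime f) (hg : PolyTime g) : PolyTime fun x => if c x then f x else g x := by
  simpa [Bool.cond_decide] using hc.cond hf hg

@[fun_prop]
theorem not {c : X → Bool} (hc : PolyTime c) : PolyTime fun x => !c x := by
  have := hc.cond (const (X := X) false) (const true)
  refine this.congr_enc fun x => ?_
  cases c x <;> rfl

theorem decide_and {c d : X → Prop} [DecidablePred c] [DecidablePred d]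
    (hc : PolyTime fun x => decide (c x)) (hd : PolyTime fun x => decide (d x)) :
    PolyTime fun x => decide (c x ∧ d x) := by
  refine (hc.cond hd (const false)).congr_enc fun x => ?_
  by_cases h : c x <;> simp [h]

theorem decide_or {c d : X → Prop} [DecidablePred c] [DecidablePred d]
    (hc : PolyTime fun x => decide (c x)) (hd : PolyTime fun x => decide (d x)) :
    PolyTime fun x => decide (c x ∨ d x) := by
  refine (hc.cond (const true) hd).congr_enc fun x => ?_
  by_cases h : c x <;> simp [h]

@[fun_prop]
theorem list_cons {f : X → A} {g : X → List A} (hf : PolyTime f) (hg : PolyTime g) :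
    PolyTime fun x => f x :: g x := (hf.pair hg).congr_enc fun _ => rfl

@[fun_prop]
theorem tail {f : X → List A} (hf : PolyTime f) : PolyTime fun x => (f x).tail :=
  comp (g := fun l : List A => l.tail)
    (of_polySize .tail .self fun l => ⟨_, by cases l <;> exact .tail _, le_rfl⟩) hf

@[fun_prop]
theorem headD {f : X → List A} {d : X → A} (hf : PolyTime f) (hd : PolyTime d) :
    PolyTime fun x => (f x).headD (d x) := by
  obtain ⟨p, b, hb, hp⟩ := hf.exists_runs
  obtain ⟨q, e, he, hq⟩ := hd.exists_runs
  have hs : PolySize fun x => esize (f x) := hf.polySize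
  refine of_polySize (.ite p (.comp p .head) q)
    (((hb.add hb).add (hs.add he)).add .self) fun x => ?_
  obtain ⟨s, h1, h2⟩ := hp x
  cases h : f x with
  | nil =>
    obtain ⟨t, h3, h4⟩ := hq x
    rw [h] at h1
    exact ⟨_, .iteFalse h1 h3, by change s + t + esize x ≤ _; omega⟩
  | cons a l =>
    rw [h] at h1
    refine ⟨_, .iteTrue h1 (by simp) (.comp h1 (.head _)), ?_⟩
    change s + (s + esize (a :: l)) + esize x ≤ _
    omega

/-- Iteration along a list, when all intermediate results have polynomial size. -/
theorem foldl {l : X → List A} {b : X → B} {g : X → B → A → B} (hl : PolyTime l)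
    (hb : PolyTime b) (hg : PolyTime fun y : X × B × A => g y.1 y.2.1 y.2.2) {c : X → ℕ}
    (hc : PolySize c)
    (h : ∀ x l', l' <+: l x → esize (l'.foldl (g x) (b x)) ≤ c x) :
    PolyTime fun x => (l x).foldl (g x) (b x) := by
  obtain ⟨p, P, hp⟩ := hg
  have hls := hl.polySize
  -- The loop state is the triple of remaining list, parameter and accumulator. The loop test on the
  -- left subtree asks whether the list is nonempty, because `enc` maps exactly the empty list to
  -- `nil`. The body drops the first element and runs `p` on the parameter, the accumulator and that
  -- element.
  set body : TreeProgram :=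
    .cons (.comp .head .tail) (.cons (.comp .tail .head)
      (.comp (.cons (.comp .tail .head) (.cons (.comp .tail .tail) (.comp .head .head))) p))
    with hbody
  -- `N` bounds the list and all accumulators at once, so every round has the same cost bound. The
  -- factor 40 is a generous allowance for moving the data.
  have key : ∀ (x : X) (N : ℕ) (l' : List A) (b' : B), esize l' ≤ N →
      (∀ l'', l'' <+: l' → esize (l''.foldl (g x) b') ≤ N) → ∃ t,
      (TreeProgram.loop body).Runs (.cons (enc l') (.cons (enc x) (enc b')))
        (.cons .nil (.cons (enc x) (enc (l'.foldl (g x) b')))) t ∧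
      t ≤ (l'.length + 1) * (P.eval (esize x + N + N + 2) + 40 * (esize x + N + N + 2)) := by
    intro x N l'
    induction l' with
    | nil =>
      intro b' hN h'
      refine ⟨_, .loopStop rfl, ?_⟩
      have h0 := h' [] (List.prefix_rfl)
      simp only [List.foldl_nil] at h0
      change (1 : ℕ) + (esize x + esize b' + 1) + 1 ≤ _
      simp only [List.length_nil]
      omega
    | cons a l' ih =>
      intro b' hN h'
      rw [esize_cons] at hN
      have h0 := h' [] (List.nil_prefix)
      simp only [List.foldl_nil] at h0
      obtain ⟨t, ht, ht'⟩ := ih (g x b' a) (by omega) (fun l'' hl'' =>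
        h' (a :: l'') (List.cons_prefix_cons.2 ⟨rfl, hl''⟩))
      obtain ⟨s, hs, hs'⟩ := hp (x, b', a)
      have h1 : TreeProgram.Runs (.comp .tail .head)
        (.cons (enc (a :: l')) (.cons (enc x) (enc b'))) (enc x) _ := .comp (.tail _) (.head _)
      have h2 : TreeProgram.Runs (.comp .tail .tail)
        (.cons (enc (a :: l')) (.cons (enc x) (enc b'))) (enc b') _ := .comp (.tail _) (.tail _)
      have h3 : TreeProgram.Runs (.comp .head .head)
        (.cons (enc (a :: l')) (.cons (enc x) (enc b'))) (enc a) _ := .comp (.head _) (.head _)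
      have h4 : TreeProgram.Runs (.comp .head .tail)
        (.cons (enc (a :: l')) (.cons (enc x) (enc b'))) (enc l') _ := .comp (.head _) (.tail _)
      have hrun := TreeProgram.Runs.cons h4 (.cons h1 (.comp (.cons h1 (.cons h2 h3)) hs))
      refine ⟨_, .loopStep (by simp [BinTree.head]) hrun ht, ?_⟩
      have hmono : P.eval (esize (x, b', a)) ≤ P.eval (esize x + N + N + 2) :=
        P.eval_mono_nat (by simp only [esize_prod]; omega)
      have e1 : (enc a).size = esize a := rfl
      have e2 : (enc l').size = esize l' := rfl
      have e3 : (enc x).size = esize x := rfl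
      have e4 : (enc b').size = esize b' := rfl
      simp only [enc_cons, BinTree.size, BinTree.tail, BinTree.head, List.length_cons,
        e1, e2, e3, e4] at ht' ⊢
      rw [add_mul (l'.length + 1) 1]
      omega
  obtain ⟨pl, cl, hcl, hpl⟩ := hl.exists_runs
  obtain ⟨pb, cb, hcb, hpb⟩ := hb.exists_runs
  obtain ⟨d, hd⟩ : ∃ d : X → ℕ, d = fun x => esize (l x) + c x := ⟨_, rfl⟩
  have hdS : PolySize d := hd ▸ hls.add hc
  have hM : PolySize fun x => esize x + d x + d x + 2 :=
    (((PolySize.self).add hdS).add hdS).add (.const 2)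
  have hP : PolySize fun x => P.eval (esize x + d x + d x + 2) := by
    obtain ⟨Q, hQ⟩ := hM
    exact ⟨P.comp Q, fun x => by rw [eval_comp]; exact P.eval_mono_nat (hQ x)⟩
  refine of_polySize (.comp (.cons pl (.cons .id pb)) (.comp (.loop body) (.comp .tail .tail)))
    ((((hcl.add hcb).add ((PolySize.const 4).mul .self)).add
      (((hls.add (.const 1)).mul (hP.add ((PolySize.const 40).mul hM))))).add
      ((PolySize.const 4).mul hM)) fun x => ?_
  obtain ⟨s, h1, h2⟩ := hpl x
  obtain ⟨t, h3, h4⟩ := hpb x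
  obtain ⟨r, h5, h6⟩ := key x (d x) (l x) (b x) (by simp [hd]) (fun l'' hl'' => by
    have := h x l'' hl''; rw [hd]; exact this.trans (Nat.le_add_left _ _))
  refine ⟨_, .comp (.cons h1 (.cons (.id _) h3)) (.comp h5 (.comp (.tail _) (.tail _))), ?_⟩
  have e3 : (enc x).size = esize x := rfl
  have e4 : (enc ((l x).foldl (g x) (b x))).size = esize ((l x).foldl (g x) (b x)) := rfl
  have hlen : (l x).length ≤ esize (l x) := by
    generalize l x = k
    induction k with
    | nil => simp
    | cons a k ih => simp only [List.length_cons, esize_cons]; omega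
  have h7 := h x (l x) List.prefix_rfl
  have h8 : c x ≤ d x := by simp [hd]
  have h9 := Nat.mul_le_mul_right (P.eval (esize x + d x + d x + 2) +
    40 * (esize x + d x + d x + 2)) (Nat.add_le_add_right hlen 1)
  simp only [BinTree.size, BinTree.tail, e3, e4]
  omega

end PolyTime
end

section
variable {X Y Z A B : Type} [TreeEncoding X] [TreeEncoding Y] [TreeEncoding Z] [TreeEncoding A]
  [TreeEncoding B]

/-! ## Lists -/

namespace TreeEncoding

theorem length_le_esize (l : List A) : l.length ≤ esize l := by
  induction l with
  | nil => simp
  | cons a k ih => simp only [List.length_cons, esize_cons]; omega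

theorem esize_append (l k : List A) : esize (l ++ k) + 1 = esize l + esize k := by
  induction l with
  | nil => simp; omega
  | cons a l ih => simp only [List.cons_append, esize_cons]; omega

theorem esize_le_of_mem {l : List A} {a : A} (h : a ∈ l) : esize a ≤ esize l := by
  induction l with
  | nil => simp at h
  | cons b l ih =>
    rw [esize_cons]
    rcases List.mem_cons.1 h with rfl | h
    · omega
    · have := ih h; omega

theorem esize_list_le {l : List A} {N : ℕ} (h : ∀ a ∈ l, esize a ≤ N) :
    esize l ≤ l.length * (N + 1) + 1 := by
  induction l with
  | nil => simp
  | cons b l ih =>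
    have h1 := ih fun a ha => h a (List.mem_cons_of_mem _ ha)
    have h2 := h b List.mem_cons_self
    rw [esize_cons, List.length_cons, add_mul]
    omega

theorem esize_reverse (l : List A) : esize l.reverse = esize l := by
  induction l with
  | nil => rfl
  | cons a l ih =>
    have := esize_append l.reverse [a]
    rw [List.reverse_cons, esize_cons]
    simp only [esize_cons, esize_nil] at this
    omega

theorem esize_le_of_prefix {l k : List A} (h : l <+: k) : esize l ≤ esize k := by
  obtain ⟨r, rfl⟩ := h
  have := esize_append l r
  have := esize_pos r
  omega

end TreeEncoding

namespace PolySize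

theorem comp {f : Y → ℕ} (hf : PolySize f) {g : X → Y} (hg : PolyTime g) :
    PolySize fun x => f (g x) := hf.comp_le hg.polySize fun _ => le_rfl

/-- A polynomial bound for `f (x, a)` that holds for all elements `a` of a list. -/
theorem exists_forall_mem {f : X × A → ℕ} (hf : PolySize f) {l : X → List A} (hl : PolyTime l) :
    ∃ c : X → ℕ, PolySize c ∧ ∀ x, ∀ a ∈ l x, f (x, a) ≤ c x := by
  obtain ⟨P, hP⟩ := hf
  obtain ⟨Q, hQ⟩ := (PolySize.self.add hl.polySize).add (.const 1)
  refine ⟨fun x => (P.comp Q).eval (esize x), ⟨_, fun _ => le_rfl⟩, fun x a ha => ?_⟩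
  refine (hP _).trans ?_
  simp only [eval_comp]
  refine P.eval_mono_nat (le_trans ?_ (hQ x))
  have := esize_le_of_mem ha
  simp only [esize_prod]
  omega

theorem length {l : X → List A} (hl : PolyTime l) : PolySize fun x => (l x).length :=
  hl.polySize.mono fun _ => length_le_esize _

end PolySize

namespace PolyTime

theorem reverse_append {l k : X → List A} (hl : PolyTime l) (hk : PolyTime k) :
    PolyTime fun x => (l x).reverse ++ k x := by
  have := foldl (g := fun _ acc a => a :: acc) hl hk (by fun_prop)
    (hl.polySize.add hk.polySize) (fun x l' h => by
      have h1 : l'.foldl (fun acc a => a :: acc) (k x) = l'.reverse ++ k x := by simp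
      have h2 := esize_append l'.reverse (k x)
      have h3 := esize_le_of_prefix h
      rw [h1]
      rw [esize_reverse] at h2
      omega)
  simpa using this

@[fun_prop]
theorem reverse {l : X → List A} (hl : PolyTime l) : PolyTime fun x => (l x).reverse := by
  simpa using hl.reverse_append (const [])

@[fun_prop]
theorem append {l k : X → List A} (hl : PolyTime l) (hk : PolyTime k) :
    PolyTime fun x => l x ++ k x := by
  simpa using hl.reverse.reverse_append hk

theorem flatMap {l : X → List A} {g : X → A → List B} (hl : PolyTime l)
    (hg : PolyTime fun y : X × A => g y.1 y.2) : PolyTime fun x => (l x).flatMap (g x) := by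
  have hfold : ∀ (x : X) (l' : List A) (acc : List B),
      l'.foldl (fun acc a => acc ++ g x a) acc = acc ++ l'.flatMap (g x) := by
    intro x l'
    induction l' with
    | nil => simp
    | cons a l' ih => intro acc; simp [ih]
  obtain ⟨c, hc, hc'⟩ := hg.polySize.exists_forall_mem hl
  have := foldl (g := fun x acc a => acc ++ g x a) hl (const [])
    (append (by fun_prop) (hg.comp (f := fun y : X × List B × A => (y.1, y.2.2)) (by fun_prop)))
    (((PolySize.length hl).mul hc).add (.const 1)) (fun x l' h => by
      rw [hfold, List.nil_append]
      have h1 : ∀ l' : List A, (∀ a ∈ l', esize (g x a) ≤ c x) →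
          esize (l'.flatMap (g x)) ≤ l'.length * c x + 1 := by
        intro l'
        induction l' with
        | nil => simp
        | cons a l' ih =>
          intro h
          have h1 := ih fun a ha => h a (List.mem_cons_of_mem _ ha)
          have h2 := h a List.mem_cons_self
          have h3 := esize_append (g x a) (l'.flatMap (g x))
          rw [List.flatMap_cons, List.length_cons, add_mul]
          omega
      refine (h1 l' fun a ha => hc' x a (h.subset ha)).trans ?_
      have := Nat.mul_le_mul_right (c x) h.length_le
      omega)
  simpa [hfold] using this

theorem map {l : X → List A} {g : X → A → B} (hl : PolyTime l)
    (hg : PolyTime fun y : X × A => g y.1 y.2) : PolyTime fun x => (l x).map (g x) := by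
  have := flatMap (g := fun x a => [g x a]) hl (hg.list_cons (const []))
  simpa [← List.map_eq_flatMap] using this

theorem filter {l : X → List A} {g : X → A → Bool} (hl : PolyTime l)
    (hg : PolyTime fun y : X × A => g y.1 y.2) : PolyTime fun x => (l x).filter (g x) := by
  have := flatMap (g := fun x a => bif g x a then [a] else []) hl
    (hg.cond (by fun_prop) (by fun_prop))
  convert this using 2 with x
  induction l x with
  | nil => rfl
  | cons a l ih => rw [List.filter_cons, List.flatMap_cons, ← ih]; cases g x a <;> rfl

@[fun_prop]
theorem isEmpty {l : X → List A} (hl : PolyTime l) : PolyTime fun x => (l x).isEmpty := by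
  have := ((hl.map (g := fun _ _ => true) (by fun_prop)).headD (const false)).not
  convert this using 2 with x
  cases l x <;> rfl

/-! ## Arithmetic of binary numbers -/

theorem _root_.Nat.esize_le (n : ℕ) : esize n ≤ 4 * n.size + 1 := by
  have h : ∀ l : List Bool, (BinTree.ofList (l.map .ofBool)).size ≤ 4 * l.length + 1 := by
    intro l
    induction l with
    | nil => simp [BinTree.ofList, BinTree.size]
    | cons b l ih =>
      cases b <;> simp [BinTree.ofList, BinTree.size, BinTree.ofBool] <;> omega
  rw [← Nat.size_eq_bits_len]
  exact h n.bits

theorem _root_.Nat.size_le_esize (n : ℕ) : n.size ≤ esize n := by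
  rw [← Nat.size_eq_bits_len]
  exact length_le_esize n.bits

@[fun_prop]
theorem bits {f : X → ℕ} (hf : PolyTime f) : PolyTime fun x => (f x).bits :=
  comp (g := fun n : ℕ => n.bits) (of_enc_eq fun _ => rfl) hf

-- Zero has the empty list of bits, so a bit `false` in front of zero must be dropped. In all other
-- cases the bit is prepended.
@[fun_prop]
theorem bit {b : X → Bool} {f : X → ℕ} (hb : PolyTime b) (hf : PolyTime f) :
    PolyTime fun x => Nat.bit (b x) (f x) := by
  have := hb.cond (hb.list_cons hf.bits)
    (hf.bits.isEmpty.cond (const []) (hb.list_cons hf.bits))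
  refine this.congr_enc fun x => ?_
  have key : ∀ (b : Bool) (n : ℕ), (bif b then b :: n.bits else
      bif n.bits.isEmpty then [] else b :: n.bits) = (Nat.bit b n).bits := by
    intro b n
    rcases Nat.eq_zero_or_pos n with rfl | hn
    · cases b <;> simp [Nat.bit]
    · rw [Nat.bits_append_bit n b (fun h => by omega)]
      have : n.bits.isEmpty = false := by
        rw [List.isEmpty_eq_false_iff]
        intro h
        have : n.size = 0 := by rw [← Nat.size_eq_bits_len, h]; rfl
        rw [Nat.size_eq_zero] at this
        omega
      cases b <;> simp [this]
  rw [key]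
  rfl

@[fun_prop]
theorem bodd {f : X → ℕ} (hf : PolyTime f) : PolyTime fun x => (f x).bodd := by
  convert hf.bits.headD (const false) using 2 with x
  rw [Nat.bodd_eq_bits_head]
  cases (f x).bits <;> rfl

@[fun_prop]
theorem div2 {f : X → ℕ} (hf : PolyTime f) : PolyTime fun x => (f x).div2 := by
  refine hf.bits.tail.congr_enc fun x => ?_
  rw [← Nat.div2_bits_eq_tail]
  rfl

end PolyTime
end

/-- One step of binary addition: the summands, the carry and the digits found so far. -/
def addStep (s : ℕ × ℕ × Bool × List Bool) : ℕ × ℕ × Bool × List Bool :=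
  (s.1.div2, s.2.1.div2,
    bif s.1.bodd then (s.2.1.bodd || s.2.2.1) else (s.2.1.bodd && s.2.2.1),
    (bif s.1.bodd then (bif s.2.1.bodd then s.2.2.1 else !s.2.2.1)
      else (bif s.2.1.bodd then !s.2.2.1 else s.2.2.1)) :: s.2.2.2)

/-- One step of the comparison of two binary numbers: the numbers and the result of the
comparison of the digits read so far. -/
def leStep (s : ℕ × ℕ × Bool) : ℕ × ℕ × Bool :=
  (s.1.div2, s.2.1.div2,
    bif s.1.bodd then (bif s.2.1.bodd then s.2.2 else false)
      else (bif s.2.1.bodd then true else s.2.2))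

theorem Nat.eq_bodd_add_div2 (n : ℕ) : n = (n.bodd).toNat + 2 * n.div2 := by
  have := Nat.bodd_add_div2 n
  omega

/-- Loop invariant of schoolbook addition: the remaining summands plus the carry, followed by the
digits already found, always represent the same number. The digits are stored with the latest, most
significant one first, so folding `Nat.bit` over them restores the order. The list `L` only counts
steps. -/
theorem foldl_addStep (L : List Bool) (s : ℕ × ℕ × Bool × List Bool) :
    let r := L.foldl (fun s _ => addStep s) s
    r.1 = s.1 / 2 ^ L.length ∧ r.2.1 = s.2.1 / 2 ^ L.length ∧
    r.2.2.2.length = L.length + s.2.2.2.length ∧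
    r.2.2.2.foldl (fun n b => Nat.bit b n) (r.1 + r.2.1 + r.2.2.1.toNat) =
      s.2.2.2.foldl (fun n b => Nat.bit b n) (s.1 + s.2.1 + s.2.2.1.toNat) := by
  induction L generalizing s with
  | nil => simp
  | cons b L ih =>
    obtain ⟨h1, h2, h3, h4⟩ := ih (addStep s)
    simp only [List.foldl_cons]
    refine ⟨?_, ?_, ?_, ?_⟩
    · rw [h1]; simp only [addStep, List.length_cons, pow_succ', Nat.div2_val, Nat.div_div_eq_div_mul]
    · rw [h2]; simp only [addStep, List.length_cons, pow_succ', Nat.div2_val, Nat.div_div_eq_div_mul]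
    · rw [h3]; simp only [addStep, List.length_cons]; omega
    · rw [h4]
      obtain ⟨x, y, c, o⟩ := s
      simp only [addStep, List.foldl_cons]
      congr 1
      have hx := Nat.eq_bodd_add_div2 x
      have hy := Nat.eq_bodd_add_div2 y
      generalize x.div2 = x' at *
      generalize y.div2 = y' at *
      cases hbx : x.bodd <;> cases hby : y.bodd <;> cases c <;>
        simp [hbx, hby, Nat.bit_val] at * <;> omega

/-- Digits are read from the least significant end, so later digits override earlier ones. The flag
decides only if the unread parts are equal, and this combined comparison is invariant. -/
theorem foldl_leStep (L : List Bool) (s : ℕ × ℕ × Bool) :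
    let r := L.foldl (fun s _ => leStep s) s
    r.1 = s.1 / 2 ^ L.length ∧ r.2.1 = s.2.1 / 2 ^ L.length ∧
    ((r.1 < r.2.1 ∨ r.1 = r.2.1 ∧ r.2.2) ↔ (s.1 < s.2.1 ∨ s.1 = s.2.1 ∧ s.2.2)) := by
  induction L generalizing s with
  | nil => simp
  | cons b L ih =>
    obtain ⟨h1, h2, h4⟩ := ih (leStep s)
    simp only [List.foldl_cons]
    refine ⟨?_, ?_, ?_⟩
    · rw [h1]; simp only [leStep, List.length_cons, pow_succ', Nat.div2_val, Nat.div_div_eq_div_mul]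
    · rw [h2]; simp only [leStep, List.length_cons, pow_succ', Nat.div2_val, Nat.div_div_eq_div_mul]
    · rw [h4]
      obtain ⟨x, y, c⟩ := s
      simp only [leStep]
      have hx := Nat.eq_bodd_add_div2 x
      have hy := Nat.eq_bodd_add_div2 y
      generalize x.div2 = x' at *
      generalize y.div2 = y' at *
      cases hbx : x.bodd <;> cases hby : y.bodd <;> cases c <;>
        simp [hbx, hby] at * <;> omega

theorem size_foldl_bit_le (L : List Bool) (n : ℕ) :
    (L.foldl (fun n b => Nat.bit b n) n).size ≤ L.length + n.size := by
  induction L generalizing n with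
  | nil => simp
  | cons b L ih =>
    have h := ih (Nat.bit b n)
    have : (Nat.bit b n).size ≤ n.size + 1 := by
      rw [Nat.size_le, pow_succ]
      have := Nat.lt_size_self n
      cases b <;> simp [Nat.bit_val] <;> omega
    simp only [List.foldl_cons, List.length_cons]
    omega

theorem foldl_bit_reverse_bits (n : ℕ) :
    n.bits.reverse.foldl (fun n b => Nat.bit b n) 0 = n := by
  rw [List.foldl_reverse]
  induction n using Nat.binaryRec' with
  | zero => simp
  | bit b n h ih => rw [Nat.bits_append_bit n b h, List.foldr_cons, ih]

section
variable {X Y Z A B : Type} [TreeEncoding X] [TreeEncoding Y] [TreeEncoding Z] [TreeEncoding A]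
  [TreeEncoding B]

namespace PolyTime

theorem addStep_comp {f : X → ℕ × ℕ × Bool × List Bool} (hf : PolyTime f) :
    PolyTime fun x => addStep (f x) := by
  unfold addStep
  have h : ∀ (b c : Bool), (b || c) = bif b then true else c := by decide
  have h' : ∀ (b c : Bool), (b && c) = bif b then c else false := by decide
  simp only [h, h']
  fun_prop

theorem leStep_comp {f : X → ℕ × ℕ × Bool} (hf : PolyTime f) :
    PolyTime fun x => leStep (f x) := by
  unfold leStep
  fun_prop

theorem _root_.Nat.size_div_le (a k : ℕ) : (a / k).size ≤ a.size :=
  Nat.size_le_size (Nat.div_le_self a k)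

theorem esize_div_le (a k : ℕ) : esize (a / k) ≤ 4 * esize a + 1 := by
  have h1 := Nat.esize_le (a / k)
  have h2 := Nat.size_div_le a k
  have h3 := Nat.size_le_esize a
  omega

theorem esize_bool_le (b : Bool) : esize b ≤ 3 := by cases b <;> decide

theorem esize_list_bool_le (l : List Bool) : esize l ≤ l.length * 4 + 1 :=
  esize_list_le fun b _ => esize_bool_le b

theorem div_two_pow_eq_zero {a k : ℕ} (h : a.size ≤ k) : a / 2 ^ k = 0 :=
  Nat.div_eq_of_lt (Nat.size_le.1 h)

theorem foldl_bit {l : X → List Bool} {n : X → ℕ} (hl : PolyTime l) (hn : PolyTime n) :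
    PolyTime fun x => (l x).foldl (fun n b => Nat.bit b n) (n x) := by
  refine foldl (g := fun _ n b => Nat.bit b n) hl hn (by fun_prop)
    ((((PolySize.const 4).mul ((PolySize.length hl).add hn.polySize)).add (.const 1)))
    fun x l' h => ?_
  refine (Nat.esize_le _).trans ?_
  have h1 := size_foldl_bit_le l' (n x)
  have h2 := h.length_le
  have h3 := Nat.size_le_esize (n x)
  omega

@[fun_prop]
theorem add {f g : X → ℕ} (hf : PolyTime f) (hg : PolyTime g) : PolyTime fun x => f x + g x := by
  -- The concatenated bit lists serve only as a clock that is long enough for both summands to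
  -- become zero. What then remains is the carry, which is the leading digit.
  have h1 : PolyTime fun x => ((f x).bits ++ (g x).bits).foldl (fun s _ => addStep s)
      (f x, g x, false, ([] : List Bool)) := by
    refine foldl (g := fun _ s _ => addStep s)
      (c := fun x => 4 * esize (f x) + 1 + (4 * esize (g x) + 1) + 6 +
        4 * ((f x).bits ++ (g x).bits).length + 1) (by fun_prop) (by fun_prop)
      (addStep_comp (by fun_prop)) ?_ fun x l' h => ?_
    · have := PolySize.length (l := fun x => (f x).bits ++ (g x).bits) (by fun_prop)
      exact (((((((PolySize.const 4).mul hf.polySize).add (.const 1)).add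
        (((PolySize.const 4).mul hg.polySize).add (.const 1))).add (.const 6)).add
        ((PolySize.const 4).mul this)).add (.const 1))
    · obtain ⟨r1, r2, r3, -⟩ := foldl_addStep l' (f x, g x, false, [])
      generalize l'.foldl (fun s _ => addStep s) (f x, g x, false, []) = r at r1 r2 r3
      obtain ⟨a, b, c, o⟩ := r
      simp only at r1 r2 r3
      have h2 := h.length_le
      have h4 := esize_div_le (f x) (2 ^ l'.length)
      have h5 := esize_div_le (g x) (2 ^ l'.length)
      have h6 := esize_bool_le c
      have h7 := esize_list_bool_le o
      simp only [esize_prod, r1, r2]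
      simp only [List.length_nil, add_zero] at r3
      omega
  have h2 := foldl_bit h1.snd.snd.snd (h1.snd.snd.fst.cond (const 1) (const 0))
  convert h2 using 2 with x
  obtain ⟨r1, r2, -, r4⟩ := foldl_addStep ((f x).bits ++ (g x).bits) (f x, g x, false, [])
  rw [div_two_pow_eq_zero (by simp [Nat.size_eq_bits_len])] at r1 r2
  rw [r1, r2] at r4
  simp only [List.foldl_nil, Bool.toNat_false, zero_add, add_zero] at r4
  rw [← r4]
  congr 1

theorem decide_le {f g : X → ℕ} (hf : PolyTime f) (hg : PolyTime g) :
    PolyTime fun x => decide (f x ≤ g x) := by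
  have h1 : PolyTime fun x => ((f x).bits ++ (g x).bits).foldl (fun s _ => leStep s)
      (f x, g x, true) := by
    refine foldl (g := fun _ s _ => leStep s)
      (c := fun x => 4 * esize (f x) + 1 + (4 * esize (g x) + 1) + 6) (by fun_prop) (by fun_prop)
      (leStep_comp (by fun_prop)) ?_ fun x l' h => ?_
    · exact ((((PolySize.const 4).mul hf.polySize).add (.const 1)).add
        (((PolySize.const 4).mul hg.polySize).add (.const 1))).add (.const 6)
    · obtain ⟨r1, r2, -⟩ := foldl_leStep l' (f x, g x, true)
      generalize l'.foldl (fun s _ => leStep s) (f x, g x, true) = r at r1 r2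
      obtain ⟨a, b, c⟩ := r
      simp only at r1 r2
      have h4 := esize_div_le (f x) (2 ^ l'.length)
      have h5 := esize_div_le (g x) (2 ^ l'.length)
      have h6 := esize_bool_le c
      simp only [esize_prod, r1, r2]
      omega
  convert h1.snd.snd using 2 with x
  obtain ⟨r1, r2, r4⟩ := foldl_leStep ((f x).bits ++ (g x).bits) (f x, g x, true)
  rw [div_two_pow_eq_zero (by simp [Nat.size_eq_bits_len])] at r1 r2
  rw [r1, r2] at r4
  simp only [lt_self_iff_false, true_and, false_or, and_true] at r4
  rw [Bool.eq_iff_iff, decide_eq_true_iff, r4]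
  omega

theorem decide_eq {f g : X → ℕ} (hf : PolyTime f) (hg : PolyTime g) :
    PolyTime fun x => decide (f x = g x) := by
  convert (hf.decide_le hg).decide_and (hg.decide_le hf) using 2 with x
  simp [le_antisymm_iff]

@[fun_prop]
theorem mul {f g : X → ℕ} (hf : PolyTime f) (hg : PolyTime g) : PolyTime fun x => f x * g x := by
  -- Horner's scheme: reading the bits of the first factor from the top, double the accumulator and
  -- add the second factor for each bit `true`.
  have hfold : ∀ (L : List Bool) (b n : ℕ), L.foldl
      (fun acc d => acc + acc + bif d then b else 0) (n * b) =
      L.foldl (fun n d => Nat.bit d n) n * b := by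
    intro L b
    induction L with
    | nil => simp
    | cons d L ih =>
      intro n
      rw [List.foldl_cons, List.foldl_cons, ← ih]
      congr 1
      cases d <;> simp [Nat.bit_val] <;> ring
  have h1 : PolyTime fun x => (f x).bits.reverse.foldl
      (fun acc d => acc + acc + bif d then g x else 0) 0 := by
    refine foldl (g := fun x acc d => acc + acc + bif d then g x else 0)
      (c := fun x => 4 * ((f x).bits.reverse.length + esize (g x)) + 1)
      (by fun_prop) (by fun_prop) (by fun_prop) ?_ fun x l' h => ?_
    · have := PolySize.length (l := fun x => (f x).bits.reverse) (by fun_prop)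
      exact ((PolySize.const 4).mul (this.add hg.polySize)).add (.const 1)
    · have h2 := hfold l' (g x) 0
      rw [zero_mul] at h2
      rw [h2]
      refine (Nat.esize_le _).trans ?_
      have h3 := size_foldl_bit_le l' 0
      have h4 := h.length_le
      have h5 := Nat.size_le_esize (g x)
      have h6 : ∀ a b : ℕ, (a * b).size ≤ a.size + b.size := by
        intro a b
        rw [Nat.size_le, pow_add]
        exact Nat.mul_lt_mul'' (Nat.lt_size_self a) (Nat.lt_size_self b)
      have h7 := h6 (l'.foldl (fun n d => Nat.bit d n) 0) (g x)
      simp only [Nat.size_zero] at h3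
      omega
  convert h1 using 2 with x
  have h2 := hfold (f x).bits.reverse (g x) 0
  rw [zero_mul] at h2
  rw [h2, foldl_bit_reverse_bits]

end PolyTime
end

/-! ### Unary numbers, powers, indexing and selection in lists -/

section
variable {X Y Z A B : Type} [TreeEncoding X] [TreeEncoding Y] [TreeEncoding Z] [TreeEncoding A]
  [TreeEncoding B]

theorem Nat.esize_le_linear (n : ℕ) : esize n ≤ 4 * n + 1 := by
  have h1 := Nat.esize_le n
  have h2 : n.size ≤ n := Nat.size_le.2 Nat.lt_two_pow_self
  omega

theorem TreeEncoding.esize_getD_le (l : List A) (k : ℕ) (d : A) :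
    esize (l.getD k d) ≤ esize l + esize d := by
  by_cases h : k < l.length
  · rw [List.getD_eq_getElem _ _ h]
    have := esize_le_of_mem (l.getElem_mem h)
    omega
  · rw [List.getD_eq_default _ _ (by omega)]
    omega

theorem TreeEncoding.esize_replicate (k : ℕ) (a : A) :
    esize (List.replicate k a) = k * (esize a + 1) + 1 := by
  induction k with
  | zero => simp
  | succ k ih => rw [List.replicate_succ, esize_cons, ih]; ring

namespace PolyTime

@[fun_prop]
theorem length {l : X → List A} (hl : PolyTime l) : PolyTime fun x => (l x).length := by
  have := foldl (g := fun _ n _ => n + 1) (b := fun _ => 0) hl (by fun_prop) (by fun_prop)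
    (((PolySize.const 4).mul (.length hl)).add (.const 1)) (fun x l' h => by
      have h1 := Nat.esize_le_linear l'.length
      have h2 := h.length_le
      simp only [List.foldl_add_const, one_mul, zero_add]
      omega)
  simpa using this

/-- Horner's scheme again, with doubling of a list. The output is as long as the value of `f x`,
hence the value itself, and not only its bit length, must be polynomially bounded. -/
theorem unary {f : X → ℕ} (hf : PolyTime f) (hs : PolySize f) :
    PolyTime fun x => List.replicate (f x) () := by
  have hfold : ∀ (L : List Bool) (n : ℕ), L.foldl
      (fun acc d => (acc ++ acc) ++ bif d then [()] else []) (List.replicate n ()) =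
      List.replicate (L.foldl (fun n d => Nat.bit d n) n) () := by
    intro L
    induction L with
    | nil => simp
    | cons d L ih =>
      intro n
      rw [List.foldl_cons, List.foldl_cons, ← ih]
      congr 1
      refine List.eq_replicate_iff.2 ⟨?_, by simp⟩
      cases d <;> simp [Nat.bit_val] <;> omega
  have hmono : ∀ (L : List Bool) (n : ℕ), n ≤ L.foldl (fun n d => Nat.bit d n) n := by
    intro L
    induction L with
    | nil => simp
    | cons d L ih =>
      intro n
      refine le_trans ?_ (ih (Nat.bit d n))
      rw [Nat.bit_val]
      omega
  have h1 := foldl (l := fun x => (f x).bits.reverse) (b := fun _ => List.replicate 0 ())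
    (g := fun _ acc d => (acc ++ acc) ++ bif d then [()] else [])
    (by fun_prop) (by fun_prop) (by fun_prop)
    (((PolySize.const 2).mul hs).add (.const 1)) (fun x l' h => by
      rw [hfold, esize_replicate]
      have : l'.foldl (fun n d => Nat.bit d n) 0 ≤ f x := by
        conv_rhs => rw [← foldl_bit_reverse_bits (f x)]
        obtain ⟨r, hr⟩ := h
        rw [← hr, List.foldl_append]
        exact hmono _ _
      have e : esize () = 1 := rfl
      rw [e]
      omega)
  convert h1 using 2 with x
  rw [hfold, foldl_bit_reverse_bits]

theorem replicate {f : X → ℕ} {g : X → A} (hf : PolyTime f) (hs : PolySize f) (hg : PolyTime g) :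
    PolyTime fun x => List.replicate (f x) (g x) := by
  simpa using (hf.unary hs).map (g := fun x _ => g x) (by fun_prop)

theorem range {f : X → ℕ} (hf : PolyTime f) (hs : PolySize f) :
    PolyTime fun x => List.range (f x) := by
  have hfold : ∀ k : ℕ, (List.replicate k ()).foldl
      (fun (s : ℕ × List ℕ) _ => (s.1 + 1, s.2 ++ [s.1])) (0, []) = (k, List.range k) := by
    intro k
    induction k with
    | zero => rfl
    | succ k ih => rw [List.replicate_succ', List.foldl_append, ih]; simp [List.range_succ]
  have h1 := foldl (g := fun _ (s : ℕ × List ℕ) _ => (s.1 + 1, s.2 ++ [s.1]))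
    (b := fun _ => (0, [])) (hf.unary hs) (by fun_prop) (by fun_prop)
    (((((PolySize.const 4).mul hs).add (.const 1)).add
      ((hs.mul (((PolySize.const 4).mul hs).add (.const 2))).add (.const 1))).add (.const 1))
    (fun x l' h => by
      have h2 := h.length_le
      rw [List.length_replicate] at h2
      have h3 : l' = List.replicate l'.length () := by
        rw [List.eq_replicate_iff]; simp
      rw [h3, hfold, esize_prod]
      have h4 := Nat.esize_le_linear l'.length
      have h5 : esize (List.range l'.length) ≤ f x * (4 * f x + 2) + 1 := by
        refine (esize_list_le (N := 4 * f x + 1) fun a ha => ?_).trans ?_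
        · have := Nat.esize_le_linear a
          rw [List.mem_range] at ha
          omega
        · rw [List.length_range]
          exact Nat.add_le_add_right (Nat.mul_le_mul_right _ h2) 1
      simp only
      omega)
  convert h1.snd using 2 with x
  rw [hfold]

/-- The difference `a - b` is the number of `k < a` with `b ≤ k`. Counting is affordable because the
minuend has polynomial value. -/
theorem sub {f g : X → ℕ} (hf : PolyTime f) (hs : PolySize f) (hg : PolyTime g) :
    PolyTime fun x => f x - g x := by
  have h1 := ((hf.range hs).filter (g := fun x k => decide (g x ≤ k))
    (decide_le (by fun_prop) (by fun_prop))).length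
  convert h1 using 2 with x
  generalize f x = a
  generalize g x = b
  induction a with
  | zero => simp
  | succ a ih =>
    rw [List.range_succ, List.filter_append, List.length_append, ← ih]
    by_cases h : b ≤ a
    · simp [h]; omega
    · simp [h]; omega

theorem pow {f g : X → ℕ} (hf : PolyTime f) (hg : PolyTime g) (hs : PolySize g) :
    PolyTime fun x => f x ^ g x := by
  have hfold : ∀ (b k : ℕ), (List.replicate k ()).foldl (fun (s : ℕ) _ => s * b) 1 = b ^ k := by
    intro b k
    induction k with
    | zero => rfl
    | succ k ih => rw [List.replicate_succ', List.foldl_append, ih]; rfl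
  have h1 := foldl (g := fun x (s : ℕ) _ => s * f x)
    (b := fun _ => 1) (hg.unary hs) (by fun_prop) (by fun_prop)
    (((PolySize.const 4).mul ((hs.mul hf.polySize).add (.const 1))).add (.const 1))
    (fun x l' h => by
      have h2 := h.length_le
      rw [List.length_replicate] at h2
      have h3 : l' = List.replicate l'.length () := by
        rw [List.eq_replicate_iff]; simp
      rw [h3, hfold]
      have h4 : (f x ^ l'.length).size ≤ l'.length * (f x).size + 1 := by
        rw [Nat.size_le, pow_succ, mul_comm l'.length, pow_mul]
        have := Nat.pow_le_pow_left (Nat.lt_size_self (f x)).le l'.length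
        have : 0 < (2 ^ (f x).size) ^ l'.length := by positivity
        omega
      have h5 := Nat.mul_le_mul h2 (Nat.size_le_esize (f x))
      have h6 := Nat.esize_le (f x ^ l'.length)
      omega)
  convert h1 using 2 with x
  rw [hfold]

@[fun_prop]
theorem getD {l : X → List A} {k : X → ℕ} {d : X → A} (hl : PolyTime l) (hk : PolyTime k)
    (hd : PolyTime d) : PolyTime fun x => (l x).getD (k x) (d x) := by
  have hfold : ∀ (l : List A) (k : ℕ) (d : A), l.foldl
      (fun (s : ℕ × A) a => (s.1 + 1, if s.1 = k then a else s.2)) (0, d) =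
      (l.length, l.getD k d) := by
    intro l k d
    induction l using List.reverseRecOn with
    | nil => simp
    | append_singleton l a ih =>
      rw [List.foldl_append, ih]
      simp only [List.foldl_cons, List.foldl_nil, List.length_append, List.length_singleton,
        Prod.mk.injEq, true_and]
      rcases lt_trichotomy k l.length with h | h | h
      · rw [if_neg (by omega), List.getD_append _ _ _ _ h]
      · subst h; simp
      · rw [if_neg (by omega), List.getD_eq_default _ _ (by omega),
          List.getD_eq_default _ _ (by simp; omega)]
  have h1 := foldl (g := fun x (s : ℕ × A) a => (s.1 + 1, if s.1 = k x then a else s.2))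
    (b := fun x => (0, d x)) hl (by fun_prop)
    (pair (by fun_prop) (ite (decide_eq (by fun_prop) (by fun_prop)) (by fun_prop) (by fun_prop)))
    (((((PolySize.const 4).mul (.length hl)).add (.const 1)).add
      (hl.polySize.add hd.polySize)).add (.const 1))
    (fun x l' h => by
      rw [hfold, esize_prod]
      have h2 := h.length_le
      have h3 := esize_le_of_prefix h
      have h4 := Nat.esize_le_linear l'.length
      have h5 := esize_getD_le l' (k x) (d x)
      simp only
      omega)
  convert h1.snd using 2 with x
  rw [hfold]

/-- Selection of an element of a list by comparisons. -/
theorem foldl_select {l : X → List A} {b : X → A} {c : X → A → A → Bool} (hl : PolyTime l)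
    (hb : PolyTime b) (hc : PolyTime fun y : X × A × A => c y.1 y.2.1 y.2.2) :
    PolyTime fun x => (l x).foldl (fun acc a => bif c x acc a then a else acc) (b x) := by
  refine foldl (g := fun x acc a => bif c x acc a then a else acc) hl hb
    (hc.cond (by fun_prop) (by fun_prop)) (hl.polySize.add hb.polySize) fun x l' h => ?_
  have h1 : ∀ (l' : List A) (b : A), esize (l'.foldl (fun acc a => bif c x acc a then a else acc) b)
      ≤ esize l' + esize b := by
    intro l'
    induction l' with
    | nil => simp
    | cons a l' ih =>
      intro b
      have := ih (bif c x b a then a else b)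
      rw [List.foldl_cons, esize_cons]
      cases hcb : c x b a <;> simp only [hcb, cond_true, cond_false] at this ⊢ <;> omega
  have h2 := esize_le_of_prefix h
  have h3 := h1 l' (b x)
  omega

end PolyTime

/-! ## Instances and fractions -/

namespace AllocInstance

/-- The numerators and denominators of the numbers of an instance. -/
def rows (I : AllocInstance) : List (List (ℕ × ℕ)) :=
  List.ofFn fun i => List.ofFn fun j => ((I.w i j).num, (I.w i j).den)

theorem enc_rows (I : AllocInstance) : enc I.rows = enc I := by
  simp only [enc, rows, encode, List.map_ofFn, Function.comp_def]
  rfl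

/-- The numerator and the denominator of the number for agent `i` and item `j`. -/
def entry (I : AllocInstance) (i j : ℕ) : ℕ × ℕ := (I.rows.getD i []).getD j (0, 1)

theorem entry_eq (I : AllocInstance) (i : Fin I.m) (j : Fin I.n) :
    I.entry i j = ((I.w i j).num, (I.w i j).den) := by
  have h1 : (i : ℕ) < I.rows.length := by simp [rows]
  unfold entry
  rw [List.getD_eq_getElem _ _ h1]
  simp [rows]

theorem entry_snd_pos (I : AllocInstance) (i j : ℕ) : 0 < (I.entry i j).2 := by
  by_cases hi : i < I.m
  · by_cases hj : j < I.n
    · rw [I.entry_eq ⟨i, hi⟩ ⟨j, hj⟩]; exact (I.w _ _).den_pos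
    · have h1 : i < I.rows.length := by simpa [rows] using hi
      unfold entry
      rw [List.getD_eq_getElem _ _ h1, List.getD_eq_default]
      · simp
      · simp [rows]; omega
  · unfold entry
    rw [List.getD_eq_default I.rows _ (by simp [rows]; omega)]
    simp

end AllocInstance

/-- The sum of two fractions. -/
def addFrac (x y : ℕ × ℕ) : ℕ × ℕ := (x.1 * y.2 + y.1 * x.2, x.2 * y.2)

/-- The comparison of two fractions. -/
def leFrac (x y : ℕ × ℕ) : Bool := decide (x.1 * y.2 ≤ y.1 * x.2)

/-- The value of a fraction. -/
def fracVal (x : ℕ × ℕ) : ℚ≥0 := x.1 / x.2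

theorem fracVal_addFrac {x y : ℕ × ℕ} (hx : 0 < x.2) (hy : 0 < y.2) :
    fracVal (addFrac x y) = fracVal x + fracVal y := by
  have h1 : (x.2 : ℚ≥0) ≠ 0 := by exact_mod_cast hx.ne'
  have h2 : (y.2 : ℚ≥0) ≠ 0 := by exact_mod_cast hy.ne'
  simp only [fracVal, addFrac]
  push_cast
  field_simp

theorem leFrac_iff {x y : ℕ × ℕ} (hx : 0 < x.2) (hy : 0 < y.2) :
    leFrac x y = true ↔ fracVal x ≤ fracVal y := by
  have h1 : (0 : ℚ≥0) < x.2 := by exact_mod_cast hx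
  have h2 : (0 : ℚ≥0) < y.2 := by exact_mod_cast hy
  simp only [fracVal, leFrac, decide_eq_true_iff]
  rw [div_le_div_iff₀ h1 h2]
  exact_mod_cast Iff.rfl

/-- The load of the agent `i` in the assignment given by a list. -/
def loadFrac (I : AllocInstance) (σ : List ℕ) (i : ℕ) : ℕ × ℕ :=
  (List.range I.n).foldl
    (fun acc j => if σ.getD j 0 = i then addFrac acc (I.entry i j) else acc) (0, 1)

/-- The minimum load in the assignment given by a list. -/
def minFrac (I : AllocInstance) (σ : List ℕ) : ℕ × ℕ :=
  ((List.range I.m).map (loadFrac I σ)).foldl (fun acc a => bif leFrac a acc then a else acc)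
    (loadFrac I σ 0)

namespace PolyTime

@[fun_prop]
theorem rows {f : X → AllocInstance} (hf : PolyTime f) : PolyTime fun x => (f x).rows :=
  comp (g := fun I : AllocInstance => I.rows) (of_enc_eq AllocInstance.enc_rows) hf

@[fun_prop]
theorem entry {f : X → AllocInstance} {i j : X → ℕ} (hf : PolyTime f) (hi : PolyTime i)
    (hj : PolyTime j) : PolyTime fun x => (f x).entry (i x) (j x) := by
  unfold AllocInstance.entry
  fun_prop

@[fun_prop]
theorem alloc_m {f : X → AllocInstance} (hf : PolyTime f) : PolyTime fun x => (f x).m := by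
  convert hf.rows.length using 2 with x
  simp [AllocInstance.rows]

theorem _root_.AllocInstance.headD_rows (I : AllocInstance) : (I.rows.headD []).length = I.n := by
  have h : I.rows.headD [] = I.rows.getD 0 [] := by cases I.rows <;> rfl
  rw [h, List.getD_eq_getElem _ _ (by simpa [AllocInstance.rows] using I.m_pos)]
  simp [AllocInstance.rows]

@[fun_prop]
theorem alloc_n {f : X → AllocInstance} (hf : PolyTime f) : PolyTime fun x => (f x).n := by
  convert (hf.rows.headD (const [])).length using 2 with x
  exact (AllocInstance.headD_rows _).symm

theorem _root_.PolySize.alloc_m {f : X → AllocInstance} (hf : PolyTime f) :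
    PolySize fun x => (f x).m := by
  convert PolySize.length hf.rows using 2 with x
  simp [AllocInstance.rows]

theorem _root_.PolySize.alloc_n {f : X → AllocInstance} (hf : PolyTime f) :
    PolySize fun x => (f x).n := by
  convert PolySize.length (hf.rows.headD (const [])) using 2 with x
  exact (AllocInstance.headD_rows _).symm

@[fun_prop]
theorem addFrac {f g : X → ℕ × ℕ} (hf : PolyTime f) (hg : PolyTime g) :
    PolyTime fun x => addFrac (f x) (g x) := by
  unfold _root_.addFrac
  fun_prop

@[fun_prop]
theorem leFrac {f g : X → ℕ × ℕ} (hf : PolyTime f) (hg : PolyTime g) :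
    PolyTime fun x => leFrac (f x) (g x) := by
  unfold _root_.leFrac
  exact decide_le (by fun_prop) (by fun_prop)

/-- Fractions are not reduced, so their growth has to be controlled. Numerator plus denominator is
submultiplicative under addition of fractions, hence bit lengths at most add up along a sum. -/
theorem size_addFrac_le (x y : ℕ × ℕ) : ((_root_.addFrac x y).1 + (_root_.addFrac x y).2).size ≤
    (x.1 + x.2).size + (y.1 + y.2).size := by
  rw [Nat.size_le, pow_add]
  refine lt_of_le_of_lt ?_ (Nat.mul_lt_mul'' (Nat.lt_size_self (x.1 + x.2))
    (Nat.lt_size_self (y.1 + y.2)))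
  simp only [_root_.addFrac]
  nlinarith [Nat.zero_le (x.1 * y.1)]

theorem esize_frac_le (x : ℕ × ℕ) : esize x ≤ 8 * (x.1 + x.2).size + 3 := by
  have h1 := Nat.esize_le x.1
  have h2 := Nat.esize_le x.2
  have h3 := Nat.size_le_size (show x.1 ≤ x.1 + x.2 by omega)
  have h4 := Nat.size_le_size (show x.2 ≤ x.1 + x.2 by omega)
  rw [esize_prod]
  omega

theorem size_frac_le (x : ℕ × ℕ) : (x.1 + x.2).size ≤ esize x := by
  have h1 := Nat.size_le_esize x.1
  have h2 := Nat.size_le_esize x.2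
  have h3 : (x.1 + x.2).size ≤ x.1.size + x.2.size + 1 := by
    rw [Nat.size_le, pow_succ, pow_add]
    have h1 := Nat.lt_size_self x.1
    have h2 := Nat.lt_size_self x.2
    generalize 2 ^ x.1.size = a at *
    generalize 2 ^ x.2.size = b at *
    nlinarith
  rw [esize_prod]
  omega

theorem _root_.AllocInstance.esize_entry_le (I : AllocInstance) (i j : ℕ) :
    esize (I.entry i j) ≤ esize I + 10 := by
  have h1 := esize_getD_le I.rows i []
  have h2 := esize_getD_le (I.rows.getD i []) j (0, 1)
  have h3 : esize I.rows = esize I := by unfold esize; rw [I.enc_rows]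
  have h4 : esize ((0, 1) : ℕ × ℕ) = 7 := by
    rw [esize_prod]
    have e0 : esize (0 : ℕ) = 1 := by simp [esize, enc, BinTree.ofNat, BinTree.ofList, BinTree.size]
    have e1 : esize (1 : ℕ) = 5 := by
      simp [esize, enc, BinTree.ofNat, BinTree.ofList, BinTree.size, BinTree.ofBool]
    simp [e0, e1]
  have h5 : esize ([] : List (ℕ × ℕ)) = 1 := rfl
  unfold AllocInstance.entry
  omega

theorem loadFrac {f : X → AllocInstance} {σ : X → List ℕ} {i : X → ℕ} (hf : PolyTime f)
    (hσ : PolyTime σ) (hi : PolyTime i) : PolyTime fun x => loadFrac (f x) (σ x) (i x) := by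
  unfold _root_.loadFrac
  refine foldl (g := fun x acc j => if (σ x).getD j 0 = i x
      then _root_.addFrac acc ((f x).entry (i x) j) else acc)
    (c := fun x => 8 * ((f x).n * (esize (f x) + 10) + 1) + 3)
    (hf.alloc_n.range (.alloc_n hf)) (by fun_prop)
    (ite (decide_eq (by fun_prop) (by fun_prop)) (by fun_prop) (by fun_prop)) ?_ fun x l' h => ?_
  · exact ((PolySize.const 8).mul (((PolySize.alloc_n hf).mul
      (hf.polySize.add (.const 10))).add (.const 1))).add (.const 3)
  · refine (esize_frac_le _).trans ?_
    have key : ∀ (l' : List ℕ) (s : ℕ × ℕ), ((l'.foldl (fun acc j => if (σ x).getD j 0 = i x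
        then _root_.addFrac acc ((f x).entry (i x) j) else acc) s).1 + (l'.foldl (fun acc j =>
        if (σ x).getD j 0 = i x then _root_.addFrac acc ((f x).entry (i x) j) else acc) s).2).size
        ≤ l'.length * (esize (f x) + 10) + (s.1 + s.2).size := by
      intro l'
      induction l' with
      | nil => simp
      | cons j l' ih =>
        intro s
        rw [List.foldl_cons, List.length_cons, add_mul]
        refine (ih _).trans ?_
        have h1 := size_addFrac_le s ((f x).entry (i x) j)
        have h2 := size_frac_le ((f x).entry (i x) j)
        have h3 := (f x).esize_entry_le (i x) j
        split_ifs <;> omega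
    have h1 := key l' (0, 1)
    have h2 := h.length_le
    rw [List.length_range] at h2
    have h3 := Nat.mul_le_mul_right (esize (f x) + 10) h2
    simp only [zero_add, Nat.size_one] at h1
    omega

theorem minFrac {f : X → AllocInstance} {σ : X → List ℕ} (hf : PolyTime f)
    (hσ : PolyTime σ) : PolyTime fun x => minFrac (f x) (σ x) := by
  unfold _root_.minFrac
  exact foldl_select (c := fun _ acc a => _root_.leFrac a acc)
    ((hf.alloc_m.range (.alloc_m hf)).map (loadFrac (by fun_prop) (by fun_prop) (by fun_prop)))
    (loadFrac hf hσ (const 0)) (by fun_prop)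

end PolyTime
end

/-! ## Configurations -/

/-- Bundles of values `m * 2 ^ e` with `1 ≤ m ≤ 2 * q`.  A bundle of values below `2 ^ u` has a
total of at least `2 ^ u`. -/
def classes (q u : ℕ) : List (List ℕ) :=
  (List.range (2 * u + 4 * q ^ 3 + 1)).flatMap fun e =>
    (List.range (2 * q)).map fun m => List.replicate (2 ^ (u - e)) ((m + 1) * 2 ^ e)

/-- Drop the current bundle, or add a copy of it to the configuration. -/
def configStep (s : List (List ℕ) × List ℕ) : List (List (List ℕ) × List ℕ) :=
  [(s.1.tail, s.2), (s.1, s.1.headD [] ++ s.2)]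

/-- What can be reached in `t` steps. -/
def configStates (s : List (List ℕ) × List ℕ) (t : ℕ) : List (List (List ℕ) × List ℕ) :=
  (List.replicate t ()).foldl (fun L _ => L.flatMap configStep) [s]

/-- The integer to which the value that each player should obtain is scaled. -/
def scaledTarget (q u : ℕ) : ℕ := 4 * q ^ 3 * (u + 1) * 2 ^ u

/-- A number of steps that suffices to form all relevant configurations. -/
def configSteps (q u : ℕ) : ℕ := 4 * q ^ 3 * (u + 1) + 2 * q * (2 * u + 4 * q ^ 3 + 1)

/-- Lists of integers whose sum is almost `scaledTarget q u`. -/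
def configs (q u : ℕ) : List (List ℕ) :=
  ((configStates (classes q u, []) (configSteps q u)).map Prod.snd).filter fun c =>
    decide (c.sum ≤ scaledTarget q u ∧
      q * scaledTarget q u ≤ q * c.sum + 3 * scaledTarget q u)

/-! ## The reduction -/

/-- The players with their configurations; the first entry belongs to no player. -/
def slots (q : ℕ) (I : AllocInstance) : List (ℕ × List ℕ) :=
  (I.m, []) :: (List.range I.m).flatMap fun i => (configs q I.n.size).map fun c => (i, c)

/-- The entry number `r` of `slots q I`. -/
def slot (q : ℕ) (I : AllocInstance) (r : ℕ) : ℕ × List ℕ := (slots q I).getD r (I.m, [])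

/-- The jobs: triples of the number of a configuration (`0` for the job that selects one of the
configurations of a player), a player, and a value. -/
def redJobs (q : ℕ) (I : AllocInstance) : List (ℕ × ℕ × ℕ) :=
  (List.range I.m).map (fun i => (0, i, scaledTarget q I.n.size)) ++
    (List.range (slots q I).length).flatMap fun r =>
      (slot q I r).2.map fun θ => (r + 1, (slot q I r).1, θ)

/-- The machines: resources (marked `true`), and configurations with their players. -/
def redMachines (q : ℕ) (I : AllocInstance) : List (Bool × ℕ × ℕ) :=
  (List.range I.n).map (fun j => (true, j, 0)) ++
    (List.range (slots q I).length).map fun r => (false, r + 1, (slot q I r).1)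

/-- Whether the resource `j` has for player `i` at least the value that corresponds to `θ`, when
each player should obtain the value `k / q` times the entry `i₀`, `j₀`, for `g = (i₀, j₀, k)`. -/
def fits (q : ℕ) (I : AllocInstance) (g : ℕ × ℕ × ℕ) (j i θ : ℕ) : Bool :=
  leFrac (θ * g.2.2 * (I.entry g.1 g.2.1).1, (I.entry g.1 g.2.1).2)
    ((I.entry i j).1 * (q * scaledTarget q I.n.size), (I.entry i j).2)

/-- The size of a job on a machine. -/
def redSize (q : ℕ) (I : AllocInstance) (g : ℕ × ℕ × ℕ) (M : Bool × ℕ × ℕ) (b : ℕ × ℕ × ℕ) : ℕ :=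
  bif M.1 then
    bif fits q I g M.2.1 b.2.1 b.2.2 then scaledTarget q I.n.size
      else 2 * scaledTarget q I.n.size
  else if b.2.1 = M.2.2 ∧ (b.1 = M.2.1 ∨ b.1 = 0) then b.2.2 else 2 * scaledTarget q I.n.size

theorem redMachines_length (q : ℕ) (I : AllocInstance) :
    (redMachines q I).length = I.n + (slots q I).length := by simp [redMachines]

/-- The instance of Makespan to which an instance of Santa Claus is reduced. -/
def reduction (q : ℕ) (I : AllocInstance) (g : ℕ × ℕ × ℕ) : AllocInstance where
  m := (redMachines q I).length
  n := (redJobs q I).length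
  -- The slot that belongs to no player guarantees a machine in every case.
  m_pos := by rw [redMachines_length]; simp [slots]
  w a b := (redSize q I g (redMachines q I)[a] (redJobs q I)[b] : ℕ)

/-- The player who obtains the resource `j` from an assignment for the reduced instance. -/
def owner (q : ℕ) (I : AllocInstance) (τ : List ℕ) (j : ℕ) : ℕ :=
  -- For a machine without jobs the index falls back to the length of the list, which is out of
  -- range; the default triple then assigns the resource to player `0`.
  ((redJobs q I).getD (((List.range (redJobs q I).length).filter
    fun b => decide (τ.getD b 0 = j)).headD (redJobs q I).length) (0, 0, 0)).2.1

/-- The guesses of the optimum. -/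
def guesses (q : ℕ) (I : AllocInstance) : List (ℕ × ℕ × ℕ) :=
  (List.range I.m).flatMap fun i => (List.range I.n).flatMap fun j =>
    (List.range (q * I.n + 1)).map fun k => (i, j, k)

/-- The assignment that results from a guess. -/
def candidate (q : ℕ) (A : AllocInstance → List ℕ) (I : AllocInstance) (g : ℕ × ℕ × ℕ) : List ℕ :=
  (List.range I.n).map fun j => owner q I (A (reduction q I g)) j

/-- The best of the assignments that result from the guesses. -/
def bestCandidate (q : ℕ) (A : AllocInstance → List ℕ) (I : AllocInstance) : List ℕ :=
  ((guesses q I).map (candidate q A I)).foldl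
    (fun acc σ => bif leFrac (minFrac I acc) (minFrac I σ) then σ else acc)
    (List.replicate I.n 0)

/-! ### Polynomial running time of the reduction -/

theorem length_configStates (s : List (List ℕ) × List ℕ) (t : ℕ) :
    (configStates s t).length = 2 ^ t := by
  induction t with
  | zero => rfl
  | succ t ih =>
    rw [configStates, List.replicate_succ', List.foldl_append, ← configStates]
    have : ∀ L : List (List (List ℕ) × List ℕ), (L.flatMap configStep).length = 2 * L.length := by
      intro L
      induction L with
      | nil => rfl
      | cons a L ih => rw [List.flatMap_cons, List.length_append, ih]; simp [configStep]; ring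
    simp only [List.foldl_cons, List.foldl_nil, this, ih]
    ring

theorem esize_configStates (s : List (List ℕ) × List ℕ) (t : ℕ) :
    ∀ r ∈ configStates s t, esize r.1 ≤ esize s.1 ∧ esize r.2 ≤ t * (esize s.1 + 1) + esize s.2 := by
  induction t with
  | zero =>
    intro r hr
    have : r = s := by simpa [configStates] using hr
    subst this
    simp
  | succ t ih =>
    intro r hr
    rw [configStates, List.replicate_succ', List.foldl_append, ← configStates] at hr
    simp only [List.foldl_cons, List.foldl_nil, List.mem_flatMap] at hr
    obtain ⟨p, hp, hr⟩ := hr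
    obtain ⟨h1, h2⟩ := ih p hp
    simp only [configStep, List.mem_cons, List.not_mem_nil, or_false] at hr
    have h3 : esize p.1.tail ≤ esize p.1 ∧ esize (p.1.headD []) ≤ esize p.1 + 1 := by
      cases p.1 with
      | nil => simp
      | cons a l => simp only [List.tail_cons, List.headD_cons, esize_cons]; omega
    have h4 := esize_append (p.1.headD []) p.2
    rw [add_mul]
    rcases hr with rfl | rfl <;> simp only <;> omega

section
variable {X Y Z A B : Type} [TreeEncoding X] [TreeEncoding Y] [TreeEncoding Z] [TreeEncoding A]
  [TreeEncoding B]

namespace PolyTime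

theorem list_sum {l : X → List ℕ} (hl : PolyTime l) : PolyTime fun x => (l x).sum := by
  have := foldl (g := fun _ n a => n + a) (b := fun _ => 0) hl (by fun_prop) (by fun_prop)
    (((PolySize.const 4).mul hl.polySize).add (.const 1)) (fun x l' h => by
      have key : ∀ (l' : List ℕ) (s : ℕ),
          (l'.foldl (fun n a => n + a) s).size ≤ s.size + esize l' := by
        intro l'
        induction l' with
        | nil => simp
        | cons a l' ih =>
          intro s
          have h1 := ih (s + a)
          have h2 : (s + a).size ≤ s.size + a.size + 1 := by
            rw [Nat.size_le, pow_succ, pow_add]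
            have h1 := Nat.lt_size_self s
            have h2 := Nat.lt_size_self a
            generalize 2 ^ s.size = c at *
            generalize 2 ^ a.size = d at *
            nlinarith
          have h3 := Nat.size_le_esize a
          rw [List.foldl_cons, esize_cons]
          omega
      have h1 := key l' 0
      have h2 := esize_le_of_prefix h
      have h3 := Nat.esize_le (l'.foldl (fun n a => n + a) 0)
      simp only [Nat.size_zero] at h1
      omega)
  convert this using 2 with x
  rw [List.sum_eq_foldl]

end PolyTime

theorem PolySize.of_two_pow {u : X → ℕ} (h2 : PolySize fun x => 2 ^ u x) : PolySize u :=
  h2.mono fun _ => Nat.lt_two_pow_self.le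

namespace PolyTime

theorem classes (q : ℕ) {u : X → ℕ} (hu : PolyTime u) (h2 : PolySize fun x => 2 ^ u x) :
    PolyTime fun x => classes q (u x) := by
  have hS := h2.of_two_pow
  have hB : PolySize fun x => 2 * u x + 4 * q ^ 3 + 1 :=
    (((PolySize.const 2).mul hS).add (.const _)).add (.const 1)
  have hr : PolyTime fun x => List.range (2 * u x + 4 * q ^ 3 + 1) := range (by fun_prop) hB
  have hS' : PolySize fun y : X × ℕ => u y.1 := hS.comp (g := fun y : X × ℕ => y.1) (by fun_prop)
  have h2' : PolySize fun y : X × ℕ => 2 ^ u y.1 :=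
    h2.comp (g := fun y : X × ℕ => y.1) (by fun_prop)
  have hB' : PolySize fun y : X × ℕ => 2 * u y.1 + 4 * q ^ 3 + 1 :=
    hB.comp (g := fun y : X × ℕ => y.1) (by fun_prop)
  have hsub : PolyTime fun y : X × ℕ => u y.1 - y.2 := sub (by fun_prop) hS' (by fun_prop)
  have hcop : PolyTime fun y : X × ℕ => 2 ^ (u y.1 - y.2) :=
    pow (const 2) hsub (hS'.mono fun _ => Nat.sub_le _ _)
  have hcopS : PolySize fun y : X × ℕ => 2 ^ (u y.1 - y.2) :=
    h2'.mono fun _ => Nat.pow_le_pow_right two_pos (Nat.sub_le _ _)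
  -- `map` and `flatMap` require a polynomial bound for every `e`, also outside the range that
  -- occurs, and `2 ^ e` has none for arbitrary binary `e`. Capping the exponent changes nothing
  -- within the range.
  have hpow : PolyTime fun y : X × ℕ =>
      2 ^ (if y.2 ≤ 2 * u y.1 + 4 * q ^ 3 + 1 then y.2 else 0) :=
    pow (const 2) (ite (decide_le (by fun_prop) (by fun_prop)) (by fun_prop) (by fun_prop))
      (hB'.mono fun _ => by split_ifs <;> omega)
  have hmap : PolyTime fun y : X × ℕ => (List.range (2 * q)).map fun m =>
      List.replicate (2 ^ (u y.1 - y.2))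
        ((m + 1) * 2 ^ (if y.2 ≤ 2 * u y.1 + 4 * q ^ 3 + 1 then y.2 else 0)) :=
    map (by fun_prop) (replicate (hcop.comp (f := fun z : (X × ℕ) × ℕ => z.1) (by fun_prop))
      (hcopS.comp (g := fun z : (X × ℕ) × ℕ => z.1) (by fun_prop))
      (mul (by fun_prop) (hpow.comp (f := fun z : (X × ℕ) × ℕ => z.1) (by fun_prop))))
  convert hr.flatMap (g := fun x e => (List.range (2 * q)).map fun m =>
      List.replicate (2 ^ (u x - e))
        ((m + 1) * 2 ^ (if e ≤ 2 * u x + 4 * q ^ 3 + 1 then e else 0))) hmap using 2 with x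
  unfold _root_.classes
  simp only [List.flatMap_def]
  congr 1
  refine List.map_congr_left fun e he => ?_
  rw [List.mem_range] at he
  rw [if_pos he.le]

theorem scaledTarget (q : ℕ) {u : X → ℕ} (hu : PolyTime u) (h2 : PolySize fun x => 2 ^ u x) :
    PolyTime fun x => scaledTarget q (u x) := by
  unfold _root_.scaledTarget
  exact mul (by fun_prop) (pow (const 2) hu h2.of_two_pow)

theorem configStates {s : X → List (List ℕ) × List ℕ} {t : X → ℕ} (hs : PolyTime s)
    (ht : PolyTime t) (h2 : PolySize fun x => 2 ^ t x) :
    PolyTime fun x => configStates (s x) (t x) := by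
  unfold _root_.configStates
  have hstep : PolyTime _root_.configStep := by
    unfold _root_.configStep
    fun_prop
  refine foldl (g := fun _ (L : List (List (List ℕ) × List ℕ)) _ => L.flatMap configStep)
    (c := fun x => 2 ^ t x * (esize (s x) + (t x * (esize (s x) + 1) + esize (s x)) + 1 + 1) + 1)
    (ht.unary h2.of_two_pow) (by fun_prop)
    (flatMap (by fun_prop) (hstep.comp (by fun_prop))) ?_ fun x l' h => ?_
  · exact (h2.mul (((hs.polySize.add ((h2.of_two_pow.mul (hs.polySize.add (.const 1))).add
      hs.polySize)).add (.const 1)).add (.const 1))).add (.const 1)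
  · have h3 : l' = List.replicate l'.length () := by
      rw [List.eq_replicate_iff]; simp
    have h4 := h.length_le
    rw [List.length_replicate] at h4
    rw [h3]
    change esize (_root_.configStates (s x) l'.length) ≤ _
    refine (esize_list_le
      (N := esize (s x) + (t x * (esize (s x) + 1) + esize (s x)) + 1) fun r hr => ?_).trans ?_
    · obtain ⟨h5, h6⟩ := esize_configStates (s x) l'.length r hr
      have h7 := Nat.mul_le_mul_right (esize (s x) + 1) h4
      have h8 : esize (s x).1 ≤ esize (s x) ∧ esize (s x).2 ≤ esize (s x) := by
        rw [esize_prod]; omega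
      have h9 : l'.length * (esize (s x).1 + 1) ≤ l'.length * (esize (s x) + 1) := by
        gcongr; exact h8.1
      rw [esize_prod r]
      omega
    · rw [length_configStates]
      exact Nat.add_le_add_right
        (Nat.mul_le_mul_right _ (Nat.pow_le_pow_right two_pos h4)) 1

theorem configs (q : ℕ) {u : X → ℕ} (hu : PolyTime u) (h2 : PolySize fun x => 2 ^ u x) :
    PolyTime fun x => configs q (u x) := by
  have hN := scaledTarget q hu h2
  have hN' : PolyTime fun y : X × List ℕ => _root_.scaledTarget q (u y.1) :=
    hN.comp (f := fun y : X × List ℕ => y.1) (by fun_prop)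
  have hsum : PolyTime fun y : X × List ℕ => y.2.sum := list_sum (by fun_prop)
  -- For fixed `q`, `configSteps` is linear in `u` with slope `4 q ^ 3 + 4 q`, so the number of
  -- states is a power of `2 ^ u` times a constant.
  have h3 : PolySize fun x => 2 ^ configSteps q (u x) := by
    refine (((h2.pow (4 * q ^ 3 + 4 * q)).mul
      (.const (2 ^ (4 * q ^ 3 + 2 * q * (4 * q ^ 3 + 1)))))).mono fun x => ?_
    rw [← pow_mul, ← pow_add, configSteps]
    exact Nat.pow_le_pow_right two_pos (by nlinarith)
  unfold _root_.configs
  refine filter (map (configStates (((classes q hu h2).pair (const []))) ?_ h3) (by fun_prop)) ?_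
  · unfold configSteps; fun_prop
  · refine decide_and (decide_le hsum hN') (decide_le (by fun_prop) (by fun_prop))

/-- With `u` the bit length of `n`, `2 ^ u ≤ 2 n + 1`, and `n` is the length of a row of the input.
Thus quantities exponential in `u` are polynomial in the input. -/
theorem two_pow_size {f : X → AllocInstance} (hf : PolyTime f) :
    PolySize fun x => 2 ^ (f x).n.size := by
  refine (((PolySize.const 2).mul (PolySize.alloc_n hf)).add (.const 1)).mono fun x => ?_
  generalize (f x).n = n
  rcases Nat.eq_zero_or_pos n with rfl | hn
  · simp
  · have h1 : 0 < n.size := Nat.size_pos.2 hn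
    have h2 : 2 ^ (n.size - 1) ≤ n := Nat.lt_size.1 (by omega)
    have h3 : 2 ^ n.size = 2 * 2 ^ (n.size - 1) := by
      rw [← pow_succ', Nat.sub_add_cancel h1]
    omega

@[fun_prop]
theorem size_n {f : X → AllocInstance} (hf : PolyTime f) : PolyTime fun x => (f x).n.size := by
  simp only [← Nat.size_eq_bits_len]
  fun_prop

@[fun_prop]
theorem scaledTarget_n (q : ℕ) {f : X → AllocInstance} (hf : PolyTime f) :
    PolyTime fun x => _root_.scaledTarget q (f x).n.size :=
  scaledTarget q (by fun_prop) (two_pow_size hf)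

@[fun_prop]
theorem slots (q : ℕ) {f : X → AllocInstance} (hf : PolyTime f) :
    PolyTime fun x => slots q (f x) := by
  have h1 : PolyTime fun x => _root_.configs q (f x).n.size :=
    configs q (by fun_prop) (two_pow_size hf)
  unfold _root_.slots
  refine list_cons (by fun_prop) (flatMap (hf.alloc_m.range (.alloc_m hf)) (map ?_ (by fun_prop)))
  exact h1.comp (f := fun y : X × ℕ => y.1) (by fun_prop)

@[fun_prop]
theorem slot (q : ℕ) {f : X → AllocInstance} {r : X → ℕ} (hf : PolyTime f) (hr : PolyTime r) :
    PolyTime fun x => slot q (f x) (r x) := by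
  unfold _root_.slot
  fun_prop

theorem range_length_slots (q : ℕ) {f : X → AllocInstance} (hf : PolyTime f) :
    PolyTime fun x => List.range (_root_.slots q (f x)).length :=
  (hf.slots q).length.range (.length (hf.slots q))

@[fun_prop]
theorem redJobs (q : ℕ) {f : X → AllocInstance} (hf : PolyTime f) :
    PolyTime fun x => redJobs q (f x) := by
  unfold _root_.redJobs
  exact append (map (hf.alloc_m.range (.alloc_m hf)) (by fun_prop))
    (flatMap (range_length_slots q hf) (map (by fun_prop) (by fun_prop)))

@[fun_prop]
theorem redMachines (q : ℕ) {f : X → AllocInstance} (hf : PolyTime f) :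
    PolyTime fun x => redMachines q (f x) := by
  unfold _root_.redMachines
  exact append (map (hf.alloc_n.range (.alloc_n hf)) (by fun_prop))
    (map (range_length_slots q hf) (by fun_prop))

theorem redSize (q : ℕ) {f : X → AllocInstance} {g : X → ℕ × ℕ × ℕ} {M : X → Bool × ℕ × ℕ}
    {b : X → ℕ × ℕ × ℕ} (hf : PolyTime f) (hg : PolyTime g) (hM : PolyTime M) (hb : PolyTime b) :
    PolyTime fun x => redSize q (f x) (g x) (M x) (b x) := by
  unfold _root_.redSize fits
  refine cond (by fun_prop) (cond (by fun_prop) (by fun_prop) (by fun_prop))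
    (ite (decide_and (decide_eq ?_ ?_) (decide_or (decide_eq ?_ ?_) (decide_eq ?_ ?_))) ?_ ?_) <;>
  fun_prop

theorem reduction (q : ℕ) {f : X → AllocInstance} {g : X → ℕ × ℕ × ℕ} (hf : PolyTime f)
    (hg : PolyTime g) : PolyTime fun x => reduction q (f x) (g x) := by
  have h1 : PolyTime fun x => (_root_.redMachines q (f x)).map fun M =>
      (_root_.redJobs q (f x)).map fun b => (_root_.redSize q (f x) (g x) M b, 1) :=
    map (by fun_prop) (map (by fun_prop)
      (pair (redSize q (by fun_prop) (by fun_prop) (by fun_prop) (by fun_prop)) (by fun_prop)))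
  refine h1.congr_enc fun x => ?_
  rw [← AllocInstance.enc_rows]
  congr 1
  refine List.ext_getElem (by simp [AllocInstance.rows, _root_.reduction]) fun a h1 h2 => ?_
  simp only [AllocInstance.rows, List.getElem_map, List.getElem_ofFn]
  refine List.ext_getElem (by simp [_root_.reduction]) fun b h1 h2 => ?_
  simp [_root_.reduction]

theorem owner (q : ℕ) {f : X → AllocInstance} {τ : X → List ℕ} {j : X → ℕ} (hf : PolyTime f)
    (hτ : PolyTime τ) (hj : PolyTime j) : PolyTime fun x => owner q (f x) (τ x) (j x) := by
  unfold _root_.owner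
  refine fst (snd (getD (by fun_prop) (headD (filter ((hf.redJobs q).length.range
    (.length (hf.redJobs q))) (decide_eq ?_ ?_)) ?_) ?_)) <;> fun_prop

theorem guesses (q : ℕ) : PolyTime (guesses q) := by
  unfold _root_.guesses
  have h (Y : Type) [TreeEncoding Y] : PolyTime fun y : AllocInstance × Y => y.1 := by fun_prop
  have h' (Y Z : Type) [TreeEncoding Y] [TreeEncoding Z] :
      PolyTime fun y : (AllocInstance × Y) × Z => y.1.1 := by fun_prop
  refine flatMap (id.alloc_m.range (.alloc_m id)) (flatMap ((h _).alloc_n.range (.alloc_n (h _)))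
    (map (range (by fun_prop) ?_) (by fun_prop)))
  exact ((PolySize.const q).mul (.alloc_n (h' _ _))).add (.const 1)

theorem bestCandidate (q : ℕ) {A : AllocInstance → List ℕ} (hA : PolyTime A) :
    PolyTime (bestCandidate q A) := by
  have hc : PolyTime fun y : AllocInstance × ℕ × ℕ × ℕ => candidate q A y.1 y.2 := by
    unfold candidate
    refine map ((alloc_n (by fun_prop)).range (.alloc_n (by fun_prop)))
      (owner q (by fun_prop) (hA.comp (reduction q ?_ ?_)) ?_) <;> fun_prop
  unfold _root_.bestCandidate
  refine foldl_select (c := fun I acc σ => _root_.leFrac (_root_.minFrac I acc) (_root_.minFrac I σ))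
    ((guesses q).map hc) (replicate (by fun_prop) (.alloc_n id) (by fun_prop))
    (leFrac (minFrac ?_ ?_) (minFrac ?_ ?_)) <;> fun_prop

end PolyTime
end

/-! ## Structure of the reduced instance -/

section
variable (q : ℕ) (I : AllocInstance) (g : ℕ × ℕ × ℕ)

theorem AllocInstance.fracVal_entry (i : Fin I.m) (j : Fin I.n) :
    fracVal (I.entry i j) = I.w i j := by
  rw [I.entry_eq]
  exact (I.w i j).num_div_den

theorem AllocInstance.load_eq (σ : I.Assignment) (i : Fin I.m) {s : ℕ → ℕ}
    (hs : ∀ j : Fin I.n, (σ j : ℕ) = s j) :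
    I.load σ i = ∑ j ∈ Finset.range I.n with s j = i, fracVal (I.entry i j) := by
  rw [load, Finset.sum_filter, Finset.sum_filter,
    ← Fin.sum_univ_eq_sum_range (fun j => if s j = i then fracVal (I.entry i j) else 0)]
  refine Finset.sum_congr rfl fun j _ => ?_
  rw [I.fracVal_entry, ← hs j]
  simp only [Fin.val_inj]

theorem scaledTarget_pos {q : ℕ} (hq : 0 < q) (u : ℕ) : 0 < scaledTarget q u := by
  unfold scaledTarget
  positivity

theorem slot_eq_or {r : ℕ} (hr : r < (slots q I).length) :
    slot q I r = (I.m, []) ∨ (slot q I r).1 < I.m ∧ (slot q I r).2 ∈ configs q I.n.size := by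
  have h : slot q I r ∈ slots q I := by
    rw [slot, List.getD_eq_getElem _ _ hr]
    exact List.getElem_mem hr
  rw [slots, List.mem_cons, List.mem_flatMap] at h
  rcases h with h | ⟨i, hi, h⟩
  · exact .inl h
  · obtain ⟨c, hc, h⟩ := List.mem_map.1 h
    rw [← h]
    exact .inr ⟨List.mem_range.1 hi, hc⟩

theorem exists_slot {i : ℕ} (hi : i < I.m) {c : List ℕ} (hc : c ∈ configs q I.n.size) :
    ∃ r < (slots q I).length, slot q I r = (i, c) := by
  have h : (i, c) ∈ slots q I := by
    rw [slots, List.mem_cons, List.mem_flatMap]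
    exact .inr ⟨i, List.mem_range.2 hi, List.mem_map.2 ⟨c, hc, rfl⟩⟩
  obtain ⟨r, hr, h⟩ := List.mem_iff_getElem.1 h
  exact ⟨r, hr, by rw [slot, List.getD_eq_getElem _ _ hr, h]⟩

theorem mem_redJobs {b : ℕ × ℕ × ℕ} (hb : b ∈ redJobs q I) :
    b.2.1 < I.m ∧ (b.1 = 0 ∧ b.2.2 = scaledTarget q I.n.size ∨
      ∃ r < (slots q I).length, b.1 = r + 1 ∧ b.2.1 = (slot q I r).1 ∧
        b.2.2 ∈ (slot q I r).2 ∧ (slot q I r).2 ∈ configs q I.n.size) := by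
  rw [redJobs, List.mem_append] at hb
  rcases hb with hb | hb
  · obtain ⟨i, hi, rfl⟩ := List.mem_map.1 hb
    exact ⟨List.mem_range.1 hi, .inl ⟨rfl, rfl⟩⟩
  · obtain ⟨r, hr, hb⟩ := List.mem_flatMap.1 hb
    obtain ⟨θ, hθ, rfl⟩ := List.mem_map.1 hb
    rw [List.mem_range] at hr
    rcases slot_eq_or q I hr with h | ⟨h1, h2⟩
    · rw [h] at hθ; simp at hθ
    · exact ⟨h1, .inr ⟨r, hr, rfl, rfl, hθ, h2⟩⟩

theorem filter_redJobs {r : ℕ} (hr : r < (slots q I).length) :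
    (redJobs q I).filter (fun b => decide (b.1 = r + 1)) =
      (slot q I r).2.map fun θ => (r + 1, (slot q I r).1, θ) := by
  rw [redJobs, List.filter_append, List.filter_eq_nil_iff.2, List.nil_append]
  · have key : ∀ L : ℕ, ((List.range L).flatMap fun r =>
        (slot q I r).2.map fun θ => (r + 1, (slot q I r).1, θ)).filter
        (fun b => decide (b.1 = r + 1)) =
        if r < L then (slot q I r).2.map fun θ => (r + 1, (slot q I r).1, θ) else [] := by
      intro L
      induction L with
      | zero => simp
      | succ L ih =>
        rw [List.range_succ, List.flatMap_append, List.filter_append, ih]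
        simp only [List.flatMap_cons, List.flatMap_nil, List.append_nil]
        rcases lt_trichotomy r L with h | h | h
        · rw [if_pos h, if_pos (by omega), List.filter_eq_nil_iff.2, List.append_nil]
          intro b hb
          obtain ⟨θ, -, rfl⟩ := List.mem_map.1 hb
          simp; omega
        · subst h
          rw [if_neg (by omega), if_pos (by omega), List.nil_append, List.filter_eq_self]
          intro b hb
          obtain ⟨θ, -, rfl⟩ := List.mem_map.1 hb
          simp
        · rw [if_neg (by omega), if_neg (by omega), List.filter_eq_nil_iff.2, List.append_nil]
          intro b hb
          obtain ⟨θ, -, rfl⟩ := List.mem_map.1 hb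
          simp; omega
    rw [key, if_pos hr]
  · intro b hb
    obtain ⟨i, -, rfl⟩ := List.mem_map.1 hb
    simp

/-- The first jobs are the selectors of the players. -/
theorem redJobs_getElem_selector {i : ℕ} (hi : i < I.m) :
    ∃ h : i < (redJobs q I).length, (redJobs q I)[i] = (0, i, scaledTarget q I.n.size) := by
  have h1 : i < ((List.range I.m).map fun i => (0, i, scaledTarget q I.n.size)).length := by
    simpa using hi
  have h2 : i < (redJobs q I).length := by
    rw [redJobs, List.length_append]; omega
  refine ⟨h2, ?_⟩
  simp only [redJobs]
  rw [List.getElem_append_left h1]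
  simp

theorem redJobs_eq_selector {b : ℕ} (hb : b < (redJobs q I).length)
    (h0 : (redJobs q I)[b].1 = 0) : b = (redJobs q I)[b].2.1 := by
  by_cases hi : b < I.m
  · obtain ⟨_, h⟩ := redJobs_getElem_selector q I hi
    rw [h]
  · exfalso
    have hle : ((List.range I.m).map fun i => (0, i, scaledTarget q I.n.size)).length ≤ b := by
      simpa using hi
    simp only [redJobs] at h0
    rw [List.getElem_append_right hle] at h0
    have h1 := List.getElem_mem (l := (List.range (slots q I).length).flatMap fun r =>
      (slot q I r).2.map fun θ => (r + 1, (slot q I r).1, θ))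
      (n := b - ((List.range I.m).map fun i => (0, i, scaledTarget q I.n.size)).length)
      (by have := hb; simp only [redJobs, List.length_append] at this; omega)
    obtain ⟨r, -, h2⟩ := List.mem_flatMap.1 h1
    obtain ⟨θ, -, h3⟩ := List.mem_map.1 h2
    rw [← h3] at h0
    simp at h0

theorem redMachines_getElem_resource {a : ℕ} (ha : a < I.n) :
    ∃ h : a < (redMachines q I).length, (redMachines q I)[a] = (true, a, 0) := by
  have h1 : a < ((List.range I.n).map fun j => (true, j, 0)).length := by simpa using ha
  refine ⟨by rw [redMachines_length]; omega, ?_⟩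
  simp only [redMachines]
  rw [List.getElem_append_left h1]
  simp

theorem redMachines_getElem_slot {r : ℕ} (hr : r < (slots q I).length) :
    ∃ h : I.n + r < (redMachines q I).length,
      (redMachines q I)[I.n + r] = (false, r + 1, (slot q I r).1) := by
  have h1 : ((List.range I.n).map fun j => (true, j, 0)).length ≤ I.n + r := by simp
  refine ⟨by rw [redMachines_length]; omega, ?_⟩
  simp only [redMachines]
  rw [List.getElem_append_right h1]
  simp

/-- The value that each player should obtain according to a guess. -/
def guessValue : ℚ≥0 := fracVal (I.entry g.1 g.2.1) * g.2.2 / q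

/-- The program compares integers after clearing denominators; the meaning is that the value is at
least the fraction `θ / N` of the guessed target, `N` being the scaled target. -/
theorem fits_iff {q : ℕ} (hq : 0 < q) (j i θ : ℕ) : fits q I g j i θ = true ↔
    θ * guessValue q I g ≤ fracVal (I.entry i j) * scaledTarget q I.n.size := by
  have h1 : (0 : ℚ≥0) < q := by exact_mod_cast hq
  rw [fits, leFrac_iff (by exact I.entry_snd_pos _ _) (by exact I.entry_snd_pos _ _)]
  simp only [fracVal, guessValue]
  push_cast
  have e1 : (θ : ℚ≥0) * ((I.entry g.1 g.2.1).1 / (I.entry g.1 g.2.1).2 * g.2.2 / q) * q =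
      θ * g.2.2 * (I.entry g.1 g.2.1).1 / (I.entry g.1 g.2.1).2 := by
    field_simp
  have e2 : ((I.entry i j).1 : ℚ≥0) / (I.entry i j).2 * scaledTarget q I.n.size * q =
      (I.entry i j).1 * (q * scaledTarget q I.n.size) / (I.entry i j).2 := by
    ring
  rw [← e1, ← e2]
  exact mul_le_mul_iff_of_pos_right h1

theorem reduction_load (τ : Fin (redJobs q I).length → Fin (redMachines q I).length)
    (a : Fin (redMachines q I).length) : (reduction q I g).load τ a = ((∑ b with τ b = a,
      redSize q I g (redMachines q I)[a] (redJobs q I)[b] : ℕ) : ℚ≥0) := by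
  rw [Nat.cast_sum]
  rfl

theorem reduction_load_le (τ : Fin (redJobs q I).length → Fin (redMachines q I).length)
    (a : Fin (redMachines q I).length) : ((∑ b with τ b = a,
      redSize q I g (redMachines q I)[a] (redJobs q I)[b] : ℕ) : ℚ≥0) ≤
        (reduction q I g).makespan τ := by
  rw [← reduction_load]
  exact Finset.le_sup' ((reduction q I g).load τ) (Finset.mem_univ _)

theorem reduction_makespan_le (τ : Fin (redJobs q I).length → Fin (redMachines q I).length) {N : ℕ}
    (h : ∀ a, ∑ b with τ b = a, redSize q I g (redMachines q I)[a] (redJobs q I)[b] ≤ N) :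
    (reduction q I g).makespan τ ≤ N := by
  refine Finset.sup'_le _ _ fun a _ => ?_
  refine (reduction_load q I g τ a).trans_le ?_
  exact_mod_cast h a

theorem owner_lt (τ : List ℕ) (j : ℕ) : owner q I τ j < I.m := by
  rw [owner]
  generalize List.headD _ _ = b
  by_cases h : b < (redJobs q I).length
  · rw [List.getD_eq_getElem _ _ h]
    exact (mem_redJobs q I (List.getElem_mem h)).1
  · rw [List.getD_eq_default _ _ (by omega)]
    exact I.m_pos

/-- `owner` looks at the first job found on the machine, so uniqueness of the job removes the
dependence on this choice. -/
theorem owner_eq (τ : Fin (redJobs q I).length → Fin (redMachines q I).length) {j : ℕ}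
    {b : Fin (redJobs q I).length}
    (hb : (τ b : ℕ) = j) (h : ∀ b', (τ b' : ℕ) = j → b' = b) :
    owner q I (List.ofFn fun b => (τ b : ℕ)) j = ((redJobs q I)[b]).2.1 := by
  have hget : ∀ b' : Fin (redJobs q I).length,
      (List.ofFn fun b => (τ b : ℕ)).getD b' 0 = τ b' := by
    intro b'
    rw [List.getD_eq_getElem _ _ (by simp)]
    simp
  have h1 : (List.range (redJobs q I).length).filter
      (fun b => decide ((List.ofFn fun b => (τ b : ℕ)).getD b 0 = j)) ≠ [] := by
    apply List.ne_nil_of_mem (a := (b : ℕ))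
    rw [List.mem_filter, List.mem_range, hget, decide_eq_true_iff]
    exact ⟨b.2, hb⟩
  obtain ⟨b', l, hl⟩ := List.exists_cons_of_ne_nil h1
  have h2 : b' ∈ (List.range (redJobs q I).length).filter
      (fun b => decide ((List.ofFn fun b => (τ b : ℕ)).getD b 0 = j)) := by rw [hl]; simp
  rw [List.mem_filter, List.mem_range, decide_eq_true_iff] at h2
  have h3 := h ⟨b', h2.1⟩ (by rw [← hget]; exact h2.2)
  rw [owner, hl, List.headD_cons, List.getD_eq_getElem _ _ h2.1]
  subst h3
  rfl

theorem sum_redJobs {r : ℕ} (hr : r < (slots q I).length) :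
    ∑ b : Fin (redJobs q I).length with ((redJobs q I)[b]).1 = r + 1, ((redJobs q I)[b]).2.2 =
      (slot q I r).2.sum := by
  have h1 : ((redJobs q I).map fun b => if b.1 = r + 1 then b.2.2 else 0).sum =
      (slot q I r).2.sum := by
    have h2 := congrArg (fun l => (l.map fun b : ℕ × ℕ × ℕ => b.2.2).sum) (filter_redJobs q I hr)
    simp only [List.map_map] at h2
    have h3 : ((fun b : ℕ × ℕ × ℕ => b.2.2) ∘ fun θ => (r + 1, (slot q I r).1, θ)) = id := rfl
    rw [h3, List.map_id] at h2
    rw [← h2]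
    induction redJobs q I with
    | nil => rfl
    | cons b l ih =>
      rw [List.map_cons, List.sum_cons, ih, List.filter_cons]
      by_cases h : b.1 = r + 1 <;> simp [h]
  rw [← h1, Finset.sum_filter, ← List.sum_ofFn]
  congr 1
  exact List.ext_getElem (by simp) (by simp)

end

/-! ### Soundness of the reduction -/

section
variable (q : ℕ) (I : AllocInstance) (g : ℕ × ℕ × ℕ)

/-- A good solution of the reduced instance yields a good assignment of the resources. -/
theorem reduction_sound {q : ℕ} (hq : 0 < q) (α : ℝ) (hα : 2 ≤ α)
    (τ : Fin (redJobs q I).length → Fin (redMachines q I).length)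
    (hτ : ((reduction q I g).makespan τ : ℝ) ≤ (2 - 1 / α) * scaledTarget q I.n.size)
    (σ : I.Assignment) (hσ : ∀ j, (σ j : ℕ) = owner q I (List.ofFn fun b => (τ b : ℕ)) j)
    (i : Fin I.m) :
    (1 / α - 3 / q) * (guessValue q I g : ℝ) ≤ (I.load σ i : ℝ) := by
  set N := scaledTarget q I.n.size with hN
  have hNpos : 0 < N := scaledTarget_pos hq _
  set T : ℝ := (guessValue q I g : ℝ) with hT
  have hT0 : 0 ≤ T := by rw [hT]; exact_mod_cast (guessValue q I g).2
  have hα0 : 0 < 1 / α := by positivity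
  have hα1 : 1 / α ≤ 1 := by rw [div_le_one (by linarith)]; linarith
  have hq0 : (0 : ℝ) < q := by exact_mod_cast hq
  have hN0 : (0 : ℝ) < N := by exact_mod_cast hNpos
  let jb : Fin (redJobs q I).length → ℕ × ℕ × ℕ := fun b => (redJobs q I)[b]
  let mc : Fin (redMachines q I).length → Bool × ℕ × ℕ := fun a => (redMachines q I)[a]
  let V : ℕ → ℝ := fun j => (fracVal (I.entry i j) : ℝ)
  have hV0 : ∀ j, 0 ≤ V j := fun j => by
    simp only [V]; exact_mod_cast (fracVal (I.entry i j)).2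
  let own : ℕ → ℕ := owner q I (List.ofFn fun b => (τ b : ℕ))
  have hload : (I.load σ i : ℝ) = ∑ j ∈ Finset.range I.n with own j = i, V j := by
    rw [I.load_eq σ i (s := own) hσ]
    push_cast
    rfl
  -- all loads are small
  have hnat : ∀ a : Fin (redMachines q I).length,
      ((∑ b with τ b = a, redSize q I g (mc a) (jb b) : ℕ) : ℝ) ≤ (2 - 1 / α) * N := by
    intro a
    have h1 := reduction_load_le q I g τ a
    refine le_trans ?_ hτ
    exact_mod_cast h1
  -- The strict inequality comes from `1 / α > 0`. It rules out every job of size `2 N` and every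
  -- pair of jobs on a resource, where each job has size at least `N`.
  have hlt : ∀ a : Fin (redMachines q I).length,
      ∑ b with τ b = a, redSize q I g (mc a) (jb b) < 2 * N := by
    intro a
    have h1 := hnat a
    have h2 : ((∑ b with τ b = a, redSize q I g (mc a) (jb b) : ℕ) : ℝ) < (2 * N : ℕ) := by
      push_cast at h1 ⊢
      nlinarith
    exact_mod_cast h2
  have hsize : ∀ b, redSize q I g (mc (τ b)) (jb b) < 2 * N := fun b =>
    lt_of_le_of_lt (Finset.single_le_sum (f := fun b' => redSize q I g (mc (τ b)) (jb b'))
      (fun _ _ => Nat.zero_le _) (by simp)) (hlt (τ b))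
  have hres : ∀ {b}, (τ b : ℕ) < I.n → mc (τ b) = (true, (τ b : ℕ), 0) := fun {b} h =>
    (redMachines_getElem_resource q I h).2
  have hslot : ∀ {b r}, (τ b : ℕ) = I.n + r → r < (slots q I).length ∧
      mc (τ b) = (false, r + 1, (slot q I r).1) := fun {b r} h => by
    have h1 : (τ b : ℕ) < (redMachines q I).length := (τ b).2
    have h3 := redMachines_length q I
    have h2 : r < (slots q I).length := by omega
    refine ⟨h2, ?_⟩
    rw [← (redMachines_getElem_slot q I h2).2]
    simp only [mc, Fin.getElem_fin, h]
  have huniq : ∀ b b', (τ b : ℕ) < I.n → (τ b' : ℕ) = τ b → b' = b := by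
    intro b b' hb hbb
    by_contra hne
    have hbb' : τ b' = τ b := Fin.ext hbb
    have h1 : ∑ b'' ∈ {b, b'}, redSize q I g (mc (τ b)) (jb b'') ≤
        ∑ b'' with τ b'' = τ b, redSize q I g (mc (τ b)) (jb b'') := by
      refine Finset.sum_le_sum_of_subset fun x hx => ?_
      rw [Finset.mem_insert, Finset.mem_singleton] at hx
      rcases hx with rfl | rfl <;> simp [hbb']
    rw [Finset.sum_pair (Ne.symm hne)] at h1
    have h2 : ∀ b'', N ≤ redSize q I g (mc (τ b)) (jb b'') := by
      intro b''
      rw [hres hb, redSize]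
      simp only [cond_true]
      cases fits q I g (τ b) (jb b'').2.1 (jb b'').2.2 <;> simp only [cond_true, cond_false] <;> omega
    have := h2 b
    have := h2 b'
    have := hlt (τ b)
    omega
  have hown : ∀ b, (τ b : ℕ) < I.n → own (τ b) = (jb b).2.1 := fun b hb =>
    owner_eq q I τ rfl fun b' hb' => huniq b b' hb hb'
  have hfit : ∀ b, (τ b : ℕ) < I.n → (jb b).2.1 = i → (jb b).2.2 * T ≤ V (τ b) * N := by
    intro b hb hi
    have h1 := hsize b
    rw [hres hb, redSize] at h1
    simp only [cond_true] at h1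
    have h2 : fits q I g (τ b) (jb b).2.1 (jb b).2.2 = true := by
      by_contra h
      rw [Bool.not_eq_true] at h
      rw [h, cond_false] at h1
      omega
    rw [fits_iff I g hq, hi] at h2
    simp only [hT, V]
    exact_mod_cast h2
  obtain ⟨hi0, hsel⟩ := redJobs_getElem_selector q I i.2
  let b0 : Fin (redJobs q I).length := ⟨i, hi0⟩
  have hb0 : jb b0 = (0, (i : ℕ), N) := hsel
  rcases lt_or_ge (τ b0 : ℕ) I.n with hb | hb
  · -- the player obtains a resource that suffices alone
    have h1 := hfit b0 hb (by rw [hb0])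
    have h2 := hown b0 hb
    rw [hb0] at h1 h2
    simp only at h1 h2
    have h3 : V (τ b0) ≤ ∑ j ∈ Finset.range I.n with own j = i, V j :=
      Finset.single_le_sum (f := V) (fun j _ => hV0 j) (by simp [hb, h2])
    rw [hload]
    have h4 : T ≤ V (τ b0) := by nlinarith
    have h5 : (1 / α - 3 / q) * T ≤ 1 * T := by
      refine mul_le_mul_of_nonneg_right ?_ hT0
      have : (0 : ℝ) < 3 / q := by positivity
      linarith
    linarith
  · obtain ⟨r, hr⟩ := Nat.exists_eq_add_of_le hb
    obtain ⟨hrl, hmc⟩ := hslot hr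
    -- On a slot of another player the selector would have size `2 N`. In particular the slot is not
    -- the dummy one, whose player number is `I.m`, so it has a genuine configuration.
    have hplayer : (slot q I r).1 = i := by
      have h1 := hsize b0
      rw [hmc, hb0, redSize] at h1
      simp only [cond_false] at h1
      by_contra hne
      rw [if_neg fun h => hne h.1.symm] at h1
      omega
    have hcfg : (slot q I r).2 ∈ configs q I.n.size := by
      rcases slot_eq_or q I hrl with h | h
      · rw [h] at hplayer
        have := i.2
        simp only at hplayer
        omega
      · exact h.2
    have hsum := sum_redJobs q I hrl
    set c := (slot q I r).2 with hc
    have hcsum : (q : ℝ) * N ≤ q * c.sum + 3 * N := by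
      rw [configs, List.mem_filter, decide_eq_true_iff] at hcfg
      exact_mod_cast hcfg.2.2
    -- the player of a job of this configuration
    have hjb : ∀ b, (jb b).1 = r + 1 → (jb b).2.1 = i := by
      intro b hb1
      obtain ⟨-, h | ⟨r', -, h1, h2, -⟩⟩ := mem_redJobs q I (List.getElem_mem b.2)
      · have : (jb b).1 = 0 := h.1
        omega
      · have h3 : r' = r := by
          have : (jb b).1 = r' + 1 := h1
          omega
        rw [h3] at h2
        exact h2.trans hplayer
    -- `B1` are the entries that stay on the slot with the selector, `B2` those that moved away. The
    -- latter can only be on resources, as foreign slots cost `2 N`.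
    set B1 := Finset.univ.filter fun b => (jb b).1 = r + 1 ∧ τ b = τ b0 with hB1
    set B2 := Finset.univ.filter fun b => (jb b).1 = r + 1 ∧ τ b ≠ τ b0 with hB2
    have hsplit : ∑ b ∈ B1, (jb b).2.2 + ∑ b ∈ B2, (jb b).2.2 = c.sum := by
      rw [← hsum, ← Finset.sum_filter_add_sum_filter_not
        (Finset.univ.filter fun b => (jb b).1 = r + 1) (fun b => τ b = τ b0)]
      simp only [Finset.filter_filter]
      rfl
    have hB1load : N + ∑ b ∈ B1, (jb b).2.2 ≤
        ∑ b with τ b = τ b0, redSize q I g (mc (τ b0)) (jb b) := by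
      have hnot : b0 ∉ B1 := by
        rw [hB1, Finset.mem_filter, hb0]
        simp
      have h1 : ∑ b ∈ insert b0 B1, redSize q I g (mc (τ b0)) (jb b) ≤
          ∑ b with τ b = τ b0, redSize q I g (mc (τ b0)) (jb b) := by
        refine Finset.sum_le_sum_of_subset fun x hx => ?_
        rw [Finset.mem_insert] at hx
        rcases hx with rfl | hx
        · simp
        · rw [hB1, Finset.mem_filter] at hx
          simp [hx.2.2]
      rw [Finset.sum_insert hnot] at h1
      refine le_trans (le_of_eq ?_) h1
      congr 1
      · rw [hmc, hb0, redSize]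
        simp [hplayer]
      · refine Finset.sum_congr rfl fun b hb => ?_
        rw [hB1, Finset.mem_filter] at hb
        rw [hmc, redSize]
        simp [hplayer, hjb b hb.2.1, hb.2.1]
    have hB2res : ∀ b ∈ B2, (τ b : ℕ) < I.n := by
      intro b hb2
      rw [hB2, Finset.mem_filter] at hb2
      by_contra hge
      obtain ⟨r', hr'⟩ := Nat.exists_eq_add_of_le (not_lt.1 hge)
      have hne : r' ≠ r := by
        rintro rfl
        exact hb2.2.2 (Fin.ext (hr'.trans hr.symm))
      have h1 := hsize b
      rw [(hslot hr').2, redSize] at h1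
      simp only [cond_false] at h1
      rw [if_neg] at h1
      · omega
      · rintro ⟨-, h | h⟩ <;> omega
    have hB2val : (∑ b ∈ B2, ((jb b).2.2 : ℝ)) * T ≤ (I.load σ i : ℝ) * N := by
      rw [hload, Finset.sum_mul]
      have h1 : ∑ b ∈ B2, ((jb b).2.2 : ℝ) * T ≤ ∑ b ∈ B2, V (τ b) * N := by
        refine Finset.sum_le_sum fun b hb2 => hfit b (hB2res b hb2) ?_
        rw [hB2, Finset.mem_filter] at hb2
        exact hjb b hb2.2.1
      refine h1.trans ?_
      rw [← Finset.sum_mul]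
      refine mul_le_mul_of_nonneg_right ?_ hN0.le
      rw [← Finset.sum_image (f := V) (g := fun b => (τ b : ℕ)) (s := B2)]
      · refine Finset.sum_le_sum_of_subset_of_nonneg (fun j hj => ?_) fun j _ _ => hV0 j
        obtain ⟨b, hb2, rfl⟩ := Finset.mem_image.1 hj
        have h2 := hB2res b hb2
        rw [hB2, Finset.mem_filter] at hb2
        rw [Finset.mem_filter, Finset.mem_range]
        exact ⟨h2, (hown b h2).trans (hjb b hb2.2.1)⟩
      · intro b hb2 b' hb2' h
        exact (huniq b b' (hB2res b hb2) h.symm).symm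
    have h1 := hnat (τ b0)
    have h2 : ((N + ∑ b ∈ B1, (jb b).2.2 : ℕ) : ℝ) ≤
      ((∑ b with τ b = τ b0, redSize q I g (mc (τ b0)) (jb b) : ℕ) : ℝ) := by
      exact_mod_cast hB1load
    have h3 : ((∑ b ∈ B1, (jb b).2.2 + ∑ b ∈ B2, (jb b).2.2 : ℕ) : ℝ) = c.sum := by
      exact_mod_cast hsplit
    push_cast at h1 h2
    rw [Nat.cast_add, Nat.cast_sum, Nat.cast_sum] at h3
    have h4 : (1 - 3 / q) * N ≤ (c.sum : ℝ) := by
      rw [sub_mul, div_mul_eq_mul_div, sub_le_iff_le_add, one_mul, ← sub_le_iff_le_add',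
        le_div_iff₀ hq0]
      linarith
    -- The selector uses `N` of the load `(2 - 1/α) N`, so `B1` has total at most `(1 - 1/α) N`, out
    -- of a configuration of total at least `(1 - 3/q) N`.
    have h5 : (1 / α - 3 / q) * N ≤ ∑ b ∈ B2, ((jb b).2.2 : ℝ) := by
      nlinarith
    have h6 : (1 / α - 3 / q) * N * T ≤ (I.load σ i : ℝ) * N :=
      (mul_le_mul_of_nonneg_right h5 hT0).trans hB2val
    nlinarith

end

/-! ## Existence of good configurations -/

theorem Finset.exists_le_sum_eq {ι : Type} [DecidableEq ι] (A : Finset ι) (x : ι → ℕ) {k : ℕ}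
    (hk : k ≤ ∑ j ∈ A, x j) : ∃ y : ι → ℕ, (∀ j, y j ≤ x j) ∧ ∑ j ∈ A, y j = k := by
  induction A using Finset.induction_on generalizing k with
  | empty => exact ⟨fun _ => 0, fun _ => Nat.zero_le _, by simp at hk; simp [hk]⟩
  | insert a A ha ih =>
    rw [Finset.sum_insert ha] at hk
    obtain ⟨y, h1, h2⟩ := ih (k := k - min k (x a)) (by omega)
    refine ⟨Function.update y a (min k (x a)), fun j => ?_, ?_⟩
    · by_cases h : j = a
      · subst h; simp
      · simp [h, h1]
    · rw [Finset.sum_insert ha, Function.update_self, Finset.sum_congr rfl fun j hj =>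
        Function.update_of_ne (ne_of_mem_of_not_mem hj ha) _ _, h2]
      omega

theorem List.exists_chunks {ι : Type} {d : ℕ} (hd : 0 < d) (l : List ι) :
    ∃ C : List (List ι), (∀ c ∈ C, c.length = d) ∧ C.flatten.Sublist l ∧
      l.length < C.length * d + d := by
  induction h : l.length using Nat.strong_induction_on generalizing l with
  | _ n ih =>
    by_cases hn : n < d
    · exact ⟨[], by simp, by simp, by simpa using hn⟩
    · obtain ⟨C, h1, h2, h3⟩ := ih (n - d) (by omega) (l.drop d) (by simp [h])
      refine ⟨l.take d :: C, ?_, ?_, ?_⟩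
      · intro c hc
        rcases List.mem_cons.1 hc with rfl | hc
        · simp; omega
        · exact h1 c hc
      · rw [List.flatten_cons]
        conv_rhs => rw [← List.take_append_drop d l]
        exact List.Sublist.append (List.Sublist.refl _) h2
      · rw [List.length_cons, add_mul, one_mul]
        omega

/-- The definition appends steps at the end; splitting off the first step instead suits an induction
along the list of bundles. -/
theorem mem_configStates_succ {r s : List (List ℕ) × List ℕ} {t : ℕ} :
    r ∈ configStates s (t + 1) ↔ ∃ p ∈ configStep s, r ∈ configStates p t := by
  have key : ∀ (t : ℕ) (L : List (List (List ℕ) × List ℕ)),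
      r ∈ (List.replicate t ()).foldl (fun L _ => L.flatMap configStep) L ↔
        ∃ p ∈ L, r ∈ configStates p t := by
    intro t
    induction t with
    | zero =>
      intro L
      simp only [configStates, List.replicate_zero, List.foldl_nil, List.mem_singleton]
      exact ⟨fun h => ⟨r, h, rfl⟩, fun ⟨p, hp, h⟩ => h ▸ hp⟩
    | succ t ih =>
      intro L
      have hs : ∀ a, configStates a (t + 1) =
          (List.replicate t ()).foldl (fun L _ => L.flatMap configStep) (configStep a) := by
        intro a
        rw [configStates, List.replicate_succ, List.foldl_cons, List.flatMap_singleton]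
      rw [List.replicate_succ, List.foldl_cons, ih]
      simp only [hs, ih, List.mem_flatMap]
      constructor
      · rintro ⟨p, ⟨a, ha, hp⟩, hr⟩
        exact ⟨a, ha, p, hp, hr⟩
      · rintro ⟨a, ha, p, hp, hr⟩
        exact ⟨p, ⟨a, ha, hp⟩, hr⟩
  rw [configStates, List.replicate_succ, List.foldl_cons, key]
  simp

/-- For each class, add its bundle once per chunk in `D`, then drop it. This takes one step per
chunk and one per class; surplus steps idle on the empty list of bundles. The list `js'` records
which item stands behind each entry. -/
theorem exists_mem_configStates {ι : Type} [DecidableEq ι] (ρ : ι → ℕ) (cl : List (List ℕ))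
    (D : List (List (List ι))) (h : List.Forall₂ (fun B C => ∀ c ∈ C, c.map ρ = B) cl D)
    (js : List ι) (t : ℕ) (ht : (D.map List.length).sum + cl.length ≤ t) :
    ∃ (js' : List ι) (cl' : List (List ℕ)), (cl', js'.map ρ) ∈ configStates (cl, js.map ρ) t ∧
      js'.Perm (D.flatten.flatten ++ js) := by
  induction h generalizing js t with
  | nil =>
    refine ⟨js, [], ?_, by simp⟩
    clear ht
    induction t with
    | zero => simp [configStates]
    | succ t ih => exact mem_configStates_succ.2 ⟨_, by simp [configStep], ih⟩
  | @cons B C cl D hC hD ih =>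
    induction C generalizing js t with
    | nil =>
      simp only [List.map_cons, List.sum_cons, List.length_cons, List.length_nil] at ht
      obtain ⟨t, rfl⟩ := Nat.exists_eq_add_of_le' (show 1 ≤ t by omega)
      obtain ⟨js', cl', h1, h2⟩ := ih js t (by omega)
      exact ⟨js', cl', mem_configStates_succ.2 ⟨_, by simp [configStep], h1⟩, by simpa using h2⟩
    | cons c C ihC =>
      simp only [List.map_cons, List.sum_cons, List.length_cons] at ht
      obtain ⟨t, rfl⟩ := Nat.exists_eq_add_of_le' (show 1 ≤ t by omega)
      obtain ⟨js', cl', h1, h2⟩ := ihC (fun c' hc' => hC c' (List.mem_cons_of_mem _ hc'))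
        (c ++ js) t (by simp only [List.map_cons, List.sum_cons, List.length_cons]; omega)
      refine ⟨js', cl', mem_configStates_succ.2
        ⟨(B :: cl, (c ++ js).map ρ), ?_, h1⟩, ?_⟩
      · rw [List.map_append, hC c List.mem_cons_self]
        simp [configStep]
      · refine h2.trans (List.perm_iff_count.2 fun a => ?_)
        simp only [List.flatten_cons, List.flatten_append, List.count_append]
        omega

theorem scaledTarget_le (q u : ℕ) : scaledTarget q u ≤ 2 ^ (2 * u + 4 * q ^ 3) := by
  have h1 : 4 * q ^ 3 ≤ 2 ^ (4 * q ^ 3) := Nat.lt_two_pow_self.le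
  have h2 : u + 1 ≤ 2 ^ u := Nat.lt_two_pow_self
  have h3 : 2 ^ (2 * u + 4 * q ^ 3) = 2 ^ (4 * q ^ 3) * 2 ^ u * 2 ^ u := by ring
  rw [h3, scaledTarget]
  gcongr

/-- Rounding of a positive integer to few leading digits. -/
theorem exists_rounding {q u y : ℕ} (hq : 0 < q) (hy : 0 < y) (hyN : y ≤ scaledTarget q u) :
    ∃ p : ℕ × ℕ, p.1 < 2 * u + 4 * q ^ 3 + 1 ∧ p.2 < 2 * q ∧ (p.2 + 1) * 2 ^ p.1 ≤ y ∧
      q * y ≤ (q + 1) * ((p.2 + 1) * 2 ^ p.1) := by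
  have hex : ∃ e, y / 2 ^ e ≤ 2 * q := by
    refine ⟨2 * u + 4 * q ^ 3, ?_⟩
    have h1 := Nat.div_le_div_right (c := 2 ^ (2 * u + 4 * q ^ 3)) (hyN.trans (scaledTarget_le q u))
    rw [Nat.div_self (by positivity)] at h1
    omega
  classical
  -- The least shift leaving a quotient of at most `2 q`. If it is positive, the quotient is still
  -- at least `q`, so truncation costs at most the factor `(q + 1) / q`; if it is zero, nothing is
  -- lost.
  set e := Nat.find hex with he
  have h1 : y / 2 ^ e ≤ 2 * q := Nat.find_spec hex
  have h2 : e ≤ 2 * u + 4 * q ^ 3 := by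
    refine Nat.find_min' hex ?_
    have h1 := Nat.div_le_div_right (c := 2 ^ (2 * u + 4 * q ^ 3)) (hyN.trans (scaledTarget_le q u))
    rw [Nat.div_self (by positivity)] at h1
    omega
  have h3 : e = 0 ∨ q ≤ y / 2 ^ e := by
    rcases Nat.eq_zero_or_pos e with h | h
    · exact .inl h
    · right
      have h4 := Nat.find_min hex (m := e - 1) (by omega)
      rw [not_le] at h4
      have h5 : y / 2 ^ e = y / 2 ^ (e - 1) / 2 := by
        rw [Nat.div_div_eq_div_mul, ← pow_succ, Nat.sub_add_cancel h]
      omega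
  have h4 : 1 ≤ y / 2 ^ e := by
    rcases h3 with h | h
    · rw [h, pow_zero, Nat.div_one]; exact hy
    · omega
  have h5 : y / 2 ^ e - 1 + 1 = y / 2 ^ e := Nat.sub_add_cancel h4
  refine ⟨(e, y / 2 ^ e - 1), by simp only; omega, by simp only; omega, ?_, ?_⟩
  · simp only [h5]
    exact Nat.div_mul_le_self y (2 ^ e)
  · simp only [h5]
    rcases h3 with h | h
    · rw [h, pow_zero, Nat.div_one, mul_one]
      exact Nat.mul_le_mul_right _ (Nat.le_succ q)
    · have h6 := Nat.lt_div_mul_add (a := y) (b := 2 ^ e) (by positivity)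
      generalize y / 2 ^ e = M at *
      generalize 2 ^ e = E at *
      nlinarith

/-- Three losses of at most `N / q` each explain the tolerance `3 N` in `configs`: the slack `n` in
the hypothesis, the rounding to leading digits, and the items left over when each class is cut into
full bundles. -/
theorem exists_config {q u n : ℕ} (hq : 0 < q) (hn : n ≤ 2 ^ u) (A : Finset ℕ) (x : ℕ → ℕ)
    (hx : scaledTarget q u ≤ ∑ j ∈ A, x j + n) :
    ∃ js : List ℕ, ∃ c ∈ configs q u, js.Nodup ∧ (∀ j ∈ js, j ∈ A) ∧
      List.Forall₂ (fun θ j => θ ≤ x j) c js := by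
  classical
  set N := scaledTarget q u with hN
  -- Decreasing the values to a total of at most `N` ensures the upper bound required of a
  -- configuration and the bound on each value needed for rounding.
  obtain ⟨y, hyx, hysum⟩ := A.exists_le_sum_eq x (k := min N (∑ j ∈ A, x j)) (min_le_right _ _)
  have hyN : ∀ j ∈ A, y j ≤ N := fun j hj =>
    (Finset.single_le_sum (fun _ _ => Nat.zero_le _) hj).trans (hysum.le.trans (min_le_left _ _))
  -- the rounded values
  have hround : ∀ j, ∃ p : ℕ × ℕ, j ∈ A → 0 < y j → p.1 < 2 * u + 4 * q ^ 3 + 1 ∧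
      p.2 < 2 * q ∧ (p.2 + 1) * 2 ^ p.1 ≤ y j ∧ q * y j ≤ (q + 1) * ((p.2 + 1) * 2 ^ p.1) := by
    intro j
    by_cases h : j ∈ A ∧ 0 < y j
    · obtain ⟨p, hp⟩ := exists_rounding hq h.2 (hyN j h.1)
      exact ⟨p, fun _ _ => hp⟩
    · exact ⟨(0, 0), fun h1 h2 => (h ⟨h1, h2⟩).elim⟩
  choose key hkey using hround
  let val : ℕ × ℕ → ℕ := fun p => (p.2 + 1) * 2 ^ p.1
  let cop : ℕ × ℕ → ℕ := fun p => 2 ^ (u - p.1)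
  let ρ : ℕ → ℕ := fun j => val (key j)
  set A' := A.filter fun j => 0 < y j with hA'
  let Ak : ℕ × ℕ → Finset ℕ := fun p => A'.filter fun j => key j = p
  set keys : List (ℕ × ℕ) := List.range (2 * u + 4 * q ^ 3 + 1) ×ˢ List.range (2 * q) with hkeys
  have hkeysN : keys.Nodup := List.Nodup.product List.nodup_range List.nodup_range
  have hcls : classes q u = keys.map fun p => List.replicate (cop p) (val p) := by
    simp only [classes, hkeys, SProd.sprod, List.product, List.map_flatMap, List.map_map]
    rfl
  have hmemkeys : ∀ a b, (a, b) ∈ keys ↔ a < 2 * u + 4 * q ^ 3 + 1 ∧ b < 2 * q := by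
    intro a b
    rw [hkeys]
    exact List.pair_mem_product.trans (by rw [List.mem_range, List.mem_range])
  have hmem : ∀ j ∈ A', key j ∈ keys := by
    intro j hj
    rw [hA', Finset.mem_filter] at hj
    have := hkey j hj.1 hj.2
    exact (hmemkeys _ _).2 ⟨this.1, this.2.1⟩
  -- the chunks
  have hchunk : ∀ p, ∃ C : List (List ℕ), (∀ c ∈ C, c.length = cop p) ∧
      C.flatten.Sublist (Ak p).toList ∧ (Ak p).card < C.length * cop p + cop p := by
    intro p
    have := List.exists_chunks (d := cop p) (by positivity) (Ak p).toList
    simpa using this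
  choose C hC1 hC2 hC3 using hchunk
  have hCmem : ∀ p, ∀ j ∈ (C p).flatten, j ∈ A' ∧ key j = p := by
    intro p j hj
    have := (hC2 p).subset hj
    rw [Finset.mem_toList, Finset.mem_filter] at this
    exact this
  have hCval : ∀ p, ∀ c ∈ C p, c.map ρ = List.replicate (cop p) (val p) := by
    intro p c hc
    rw [List.eq_replicate_iff]
    refine ⟨by rw [List.length_map, hC1 p c hc], fun θ hθ => ?_⟩
    obtain ⟨j, hj, rfl⟩ := List.mem_map.1 hθ
    have := hCmem p j (List.mem_flatten.2 ⟨c, hc, hj⟩)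
    simp only [ρ, this.2]
  set js₀ : List ℕ := (keys.map C).flatten.flatten with hjs₀
  have hjs₀' : js₀ = keys.flatMap fun p => (C p).flatten := by
    rw [hjs₀, List.flatMap_def]
    induction keys with
    | nil => rfl
    | cons a l ih => simp [List.flatten_append, ih]
  have hjsN : js₀.Nodup := by
    rw [hjs₀', List.nodup_flatMap]
    refine ⟨fun p _ => (Finset.nodup_toList _).sublist (hC2 p), ?_⟩
    refine hkeysN.imp fun {p p'} hpp j hj hj' => hpp ?_
    rw [← (hCmem p j hj).2, (hCmem p' j hj').2]
  have hjsA : ∀ j ∈ js₀, j ∈ A' := by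
    intro j hj
    rw [hjs₀', List.mem_flatMap] at hj
    obtain ⟨p, -, hj⟩ := hj
    exact (hCmem p j hj).1
  have hρy : ∀ j ∈ A', ρ j ≤ y j := by
    intro j hj
    rw [hA', Finset.mem_filter] at hj
    exact (hkey j hj.1 hj.2).2.2.1
  have hsumle : (js₀.map ρ).sum ≤ N := by
    rw [← List.sum_toFinset ρ hjsN]
    calc ∑ j ∈ js₀.toFinset, ρ j ≤ ∑ j ∈ js₀.toFinset, y j :=
          Finset.sum_le_sum fun j hj => hρy j (hjsA j (List.mem_toFinset.1 hj))
      _ ≤ ∑ j ∈ A, y j := Finset.sum_le_sum_of_subset fun j hj =>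
          Finset.mem_of_mem_filter j (hjsA j (List.mem_toFinset.1 hj))
      _ ≤ N := hysum.le.trans (min_le_left _ _)
  have hsumeq : (js₀.map ρ).sum = ∑ p ∈ keys.toFinset, (C p).length * (cop p * val p) := by
    rw [List.sum_toFinset _ hkeysN, hjs₀']
    have h1 : ∀ p, ((C p).flatten.map ρ).sum = (C p).length * (cop p * val p) := by
      intro p
      have h2 := hCval p
      generalize C p = D at h2
      induction D with
      | nil => simp
      | cons c D ih =>
        rw [List.flatten_cons, List.map_append, List.sum_append,
          ih fun c' hc' => h2 c' (List.mem_cons_of_mem _ hc'), h2 c List.mem_cons_self,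
          List.sum_replicate, List.length_cons, smul_eq_mul]
        ring
    clear_value keys
    clear hjs₀' hjsN hjsA hsumle hjs₀ js₀ hkeysN hmem hcls hkeys hmemkeys
    induction keys with
    | nil => rfl
    | cons a l ih => rw [List.flatMap_cons, List.map_append, List.sum_append, ih, h1]; simp
  have hcv : ∀ p, 2 ^ u ≤ cop p * val p := by
    intro p
    have h1 : u ≤ (u - p.1) + p.1 := by omega
    calc 2 ^ u ≤ 2 ^ ((u - p.1) + p.1) := Nat.pow_le_pow_right two_pos h1
      _ = cop p * (1 * 2 ^ p.1) := by rw [pow_add, one_mul]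
      _ ≤ _ := by simp only [val]; gcongr; omega
  -- Each bundle contributes at least `2 ^ u` to a sum that is at most `N`, so `configSteps` allows
  -- enough additions.
  have hcount : ∑ p ∈ keys.toFinset, (C p).length ≤ 4 * q ^ 3 * (u + 1) := by
    have h1 : (∑ p ∈ keys.toFinset, (C p).length) * 2 ^ u ≤ 4 * q ^ 3 * (u + 1) * 2 ^ u := by
      refine le_trans ?_ (hsumeq ▸ hsumle)
      rw [Finset.sum_mul]
      exact Finset.sum_le_sum fun p _ => Nat.mul_le_mul_left _ (hcv p)
    exact Nat.le_of_mul_le_mul_right h1 (by positivity)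
  obtain ⟨js, cl', hjs, hperm⟩ := exists_mem_configStates ρ (classes q u) (keys.map C)
    (by
      rw [hcls, List.forall₂_map_left_iff, List.forall₂_map_right_iff, List.forall₂_same]
      exact fun p _ => hCval p)
    [] (configSteps q u) (by
      rw [hcls, List.map_map, List.length_map, hkeys, List.length_product, List.length_range,
        List.length_range, ← hkeys]
      have h1 := List.sum_toFinset (fun p => (C p).length) hkeysN
      have h2 : (keys.map (List.length ∘ C)).sum = (keys.map fun p => (C p).length).sum := rfl
      rw [h2, ← h1, configSteps]
      nlinarith)
  rw [List.append_nil, ← hjs₀] at hperm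
  have hS : (js.map ρ).sum = (js₀.map ρ).sum := (hperm.map ρ).sum_eq
  refine ⟨js, js.map ρ, ?_, hperm.nodup_iff.2 hjsN,
    fun j hj => Finset.mem_of_mem_filter j (hjsA j (hperm.subset hj)), ?_⟩
  swap
  · rw [List.forall₂_map_left_iff, List.forall₂_same]
    exact fun j hj => (hρy j (hjsA j (hperm.subset hj))).trans (hyx j)
  rw [configs, List.mem_filter, decide_eq_true_iff, hS]
  refine ⟨List.mem_map.2 ⟨_, hjs, rfl⟩, hsumle, ?_⟩
  -- the loss by dropping incomplete chunks
  have hloss : ∑ j ∈ A', ρ j ≤ (js₀.map ρ).sum + 4 * q ^ 2 * (u + 1) * 2 ^ u := by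
    have h1 : ∑ j ∈ A', ρ j = ∑ p ∈ keys.toFinset, (Ak p).card * val p := by
      rw [← Finset.sum_fiberwise_of_maps_to (t := keys.toFinset) (g := key)
        fun j hj => List.mem_toFinset.2 (hmem j hj)]
      refine Finset.sum_congr rfl fun p _ => ?_
      rw [Finset.sum_congr rfl (g := fun _ => val p), Finset.sum_const, smul_eq_mul]
      intro j hj
      rw [Finset.mem_filter] at hj
      simp only [ρ, hj.2]
    -- For exponents above `u` a bundle is a single value, and nothing is lost. Otherwise the
    -- incomplete bundle loses at most `2 q * 2 ^ u`. There are at most `(u + 1) * 2 q` such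
    -- classes, so the total loss is at most `N / q`.
    have h2 : ∀ p ∈ keys.toFinset, (Ak p).card * val p ≤ (C p).length * (cop p * val p) +
        if p.1 ≤ u then 2 * q * 2 ^ u else 0 := by
      intro p hp
      rw [List.mem_toFinset] at hp
      replace hp := (hmemkeys p.1 p.2).1 hp
      have h3 := hC3 p
      split_ifs with h
      · have h4 : cop p * val p = (p.2 + 1) * 2 ^ u := by
          simp only [cop, val]
          rw [mul_left_comm, ← pow_add, Nat.sub_add_cancel h]
        have h5 : (p.2 + 1) * 2 ^ u ≤ 2 * q * 2 ^ u := by gcongr; omega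
        calc (Ak p).card * val p ≤ ((C p).length * cop p + cop p) * val p := by gcongr
          _ = (C p).length * (cop p * val p) + cop p * val p := by ring
          _ ≤ _ := by omega
      · have h4 : cop p = 1 := by
          simp only [cop]
          rw [show u - p.1 = 0 by omega, pow_zero]
        rw [h4, add_zero, one_mul]
        rw [h4] at h3
        gcongr
        omega
    rw [h1, hsumeq]
    refine (Finset.sum_le_sum h2).trans ?_
    rw [Finset.sum_add_distrib]
    refine Nat.add_le_add_left ?_ _
    have h3 : keys.toFinset = Finset.range (2 * u + 4 * q ^ 3 + 1) ×ˢ Finset.range (2 * q) := by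
      ext ⟨a, b⟩
      rw [List.mem_toFinset, hmemkeys]
      simp
    rw [h3, Finset.sum_product]
    have h5 : ∀ e, ∑ _m ∈ Finset.range (2 * q), (if e ≤ u then 2 * q * 2 ^ u else 0) =
        2 * q * if e ≤ u then 2 * q * 2 ^ u else 0 := by
      intro e
      rw [Finset.sum_const, Finset.card_range, smul_eq_mul]
    refine (Finset.sum_congr rfl fun e _ => h5 e).trans_le ?_
    rw [← Finset.mul_sum, ← Finset.sum_filter, Finset.sum_const, smul_eq_mul]
    have h4 : ((Finset.range (2 * u + 4 * q ^ 3 + 1)).filter fun e => e ≤ u).card ≤ u + 1 := by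
      refine (Finset.card_le_card (t := Finset.range (u + 1)) fun e he => ?_).trans
        (Finset.card_range _).le
      rw [Finset.mem_filter] at he
      rw [Finset.mem_range]
      omega
    calc 2 * q * (((Finset.range (2 * u + 4 * q ^ 3 + 1)).filter fun e => e ≤ u).card *
          (2 * q * 2 ^ u)) ≤ 2 * q * ((u + 1) * (2 * q * 2 ^ u)) := by gcongr
      _ = _ := by ring
  have hround' : q * ∑ j ∈ A, y j ≤ (q + 1) * ∑ j ∈ A', ρ j := by
    have h1 : ∑ j ∈ A, y j = ∑ j ∈ A', y j := by
      rw [hA', Finset.sum_filter]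
      refine Finset.sum_congr rfl fun j _ => ?_
      split_ifs <;> omega
    rw [h1, Finset.mul_sum, Finset.mul_sum]
    refine Finset.sum_le_sum fun j hj => ?_
    rw [hA', Finset.mem_filter] at hj
    exact (hkey j hj.1 hj.2).2.2.2
  have hqn : q * n ≤ N := by
    calc q * n ≤ q * 2 ^ u := by gcongr
      _ ≤ 4 * q ^ 3 * (u + 1) * 2 ^ u := by
          gcongr
          nlinarith [Nat.pow_le_pow_right hq (show 1 ≤ 3 by norm_num), Nat.zero_le (q ^ 3 * u)]
  have hLN : q * (4 * q ^ 2 * (u + 1) * 2 ^ u) = N := by rw [hN, scaledTarget]; ring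
  have hlow : N ≤ ∑ j ∈ A, y j + n := by rw [hysum]; omega
  generalize (js₀.map ρ).sum = S at *
  generalize ∑ j ∈ A', ρ j = R at *
  generalize ∑ j ∈ A, y j = Y at *
  generalize 4 * q ^ 2 * (u + 1) * 2 ^ u = Λ at *
  have h1 : q * (q * N) ≤ q * ((q + 1) * R) + q * N := by
    have h1 := Nat.mul_le_mul_left q hround'
    have h2 := Nat.mul_le_mul_left (q * q) hlow
    have h3 := Nat.mul_le_mul_left q hqn
    linarith
  have h2 : q * ((q + 1) * R) ≤ (q + 1) * (q * S + N) := by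
    have h1 := Nat.mul_le_mul_left (q * (q + 1)) hloss
    have h2 : (q + 1) * (q * Λ) = (q + 1) * N := by rw [hLN]
    linarith
  have h3 : (q + 1) * (q * N) ≤ (q + 1) * (q * S + 3 * N) := by
    have h4 := Nat.zero_le (q * N)
    linarith
  exact Nat.le_of_mul_le_mul_left h3 (by omega)

/-! ## Assignments for the reduced instance -/

theorem List.Forall₂.exists_injOn {α : Type} {R : α → ℕ → Prop} {l : List α}
    {k : List ℕ} (h : List.Forall₂ R l k) (hl : l.Nodup) (hk : k.Nodup) :
    ∃ f : α → ℕ, (∀ a ∈ l, f a ∈ k ∧ R a (f a)) ∧ Set.InjOn f {a | a ∈ l} := by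
  classical
  induction h with
  | nil => exact ⟨fun _ => 0, by simp, by simp⟩
  | @cons a b l k hab h ih =>
    rw [List.nodup_cons] at hl hk
    obtain ⟨f, h1, h2⟩ := ih hl.2 hk.2
    have hne : ∀ x ∈ l, x ≠ a := fun x hx hxa => hl.1 (hxa ▸ hx)
    refine ⟨fun x => if x = a then b else f x, fun x hx => ?_, fun x hx y hy hxy => ?_⟩
    · rcases List.mem_cons.1 hx with rfl | hx
      · simp [hab]
      · simp only [if_neg (hne x hx)]
        exact ⟨List.mem_cons_of_mem _ (h1 x hx).1, (h1 x hx).2⟩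
    · rcases List.mem_cons.1 hx with rfl | hx' <;> rcases List.mem_cons.1 hy with rfl | hy'
      · rfl
      · simp only [if_neg (hne y hy'), if_true] at hxy
        exact (hk.1 (hxy ▸ (h1 y hy').1)).elim
      · simp only [if_neg (hne x hx'), if_true] at hxy
        exact (hk.1 (hxy ▸ (h1 x hx').1)).elim
      · simp only [if_neg (hne x hx'), if_neg (hne y hy')] at hxy
        exact h2 hx' hy' hxy

section
variable (q : ℕ) (I : AllocInstance) (g : ℕ × ℕ × ℕ)

/-- The values of the jobs of a configuration are the entries of the configuration. -/
theorem map_filter_finRange {r : ℕ} (hr : r < (slots q I).length) :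
    (((List.finRange (redJobs q I).length).filter
      fun b => decide (((redJobs q I)[b]).1 = r + 1)).map fun b => ((redJobs q I)[b]).2.2) =
      (slot q I r).2 := by
  have h1 : (List.finRange (redJobs q I).length).map (fun b => (redJobs q I)[b]) = redJobs q I :=
    List.ext_getElem (by simp) (by simp)
  have h2 := congrArg (List.map fun b : ℕ × ℕ × ℕ => b.2.2) (filter_redJobs q I hr)
  rw [List.map_map] at h2
  have h3 : ((fun b : ℕ × ℕ × ℕ => b.2.2) ∘ fun θ => (r + 1, (slot q I r).1, θ)) = id := rfl
  rw [h3, List.map_id] at h2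
  rw [← h2]
  conv_rhs => rw [← h1, List.filter_map, List.map_map]
  rfl

/-- Scale the values of the player's resources by `N / T` and round down to integers. This loses
less than 1 per resource, which is the slack `n` allowed in `exists_config`; the integers fit by
definition. -/
theorem exists_player_config {q : ℕ} (hq : 0 < q) (hT0 : 0 < guessValue q I g) (σ : I.Assignment)
    (i : Fin I.m) (hT : guessValue q I g ≤ I.load σ i) :
    ∃ r < (slots q I).length, (slot q I r).1 = i ∧
      ∃ f : Fin (redJobs q I).length → ℕ,
        (∀ b, ((redJobs q I)[b]).1 = r + 1 → (∃ h : f b < I.n, σ ⟨f b, h⟩ = i) ∧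
          fits q I g (f b) i ((redJobs q I)[b]).2.2 = true) ∧
        Set.InjOn f {b | ((redJobs q I)[b]).1 = r + 1} := by
  classical
  set N := scaledTarget q I.n.size with hN
  set T := guessValue q I g with hTdef
  let s : ℕ → ℕ := fun j => if h : j < I.n then σ ⟨j, h⟩ else I.m
  have hs : ∀ j : Fin I.n, (σ j : ℕ) = s j := fun j => by simp [s]
  rw [I.load_eq σ i hs] at hT
  set A := (Finset.range I.n).filter fun j => s j = i with hA
  let x : ℕ → ℕ := fun j => ⌊fracVal (I.entry i j) * N / T⌋₊
  have hx : N ≤ ∑ j ∈ A, x j + I.n := by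
    have h1 : (N : ℚ≥0) ≤ ∑ j ∈ A, fracVal (I.entry i j) * N / T := by
      rw [← Finset.sum_div, ← Finset.sum_mul, le_div_iff₀ hT0, mul_comm]
      gcongr
    have h2 : ∑ j ∈ A, fracVal (I.entry i j) * N / T ≤ ∑ j ∈ A, ((x j : ℚ≥0) + 1) :=
      Finset.sum_le_sum fun j _ => (Nat.lt_floor_add_one _).le
    have h3 : A.card ≤ I.n := (Finset.card_filter_le _ _).trans (Finset.card_range _).le
    have h4 : (N : ℚ≥0) ≤ ((∑ j ∈ A, x j + A.card : ℕ) : ℚ≥0) := by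
      refine (h1.trans h2).trans (le_of_eq ?_)
      rw [Finset.sum_add_distrib]
      simp
    have h5 : N ≤ ∑ j ∈ A, x j + A.card := by exact_mod_cast h4
    omega
  obtain ⟨js, c, hc, hnd, hjA, hR⟩ := exists_config hq (Nat.lt_size_self I.n).le A x hx
  obtain ⟨r, hr, hslot⟩ := exists_slot q I i.2 hc
  refine ⟨r, hr, by rw [hslot], ?_⟩
  have hmap := map_filter_finRange q I hr
  rw [hslot] at hmap
  simp only at hmap
  rw [← hmap, List.forall₂_map_left_iff] at hR
  obtain ⟨f, hf1, hf2⟩ := hR.exists_injOn ((List.nodup_finRange _).filter _) hnd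
  have hmem : ∀ b : Fin (redJobs q I).length, ((redJobs q I)[b]).1 = r + 1 →
      b ∈ (List.finRange (redJobs q I).length).filter
        fun b => decide (((redJobs q I)[b]).1 = r + 1) := by
    intro b hb
    rw [List.mem_filter, decide_eq_true_iff]
    exact ⟨List.mem_finRange b, hb⟩
  refine ⟨f, fun b hb => ?_, fun b hb b' hb' h => hf2 (hmem b hb) (hmem b' hb') h⟩
  obtain ⟨h1, h2⟩ := hf1 b (hmem b hb)
  have h3 := hjA _ h1
  rw [hA, Finset.mem_filter, Finset.mem_range] at h3
  refine ⟨⟨h3.1, Fin.ext ((hs ⟨f b, h3.1⟩).trans h3.2)⟩, ?_⟩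
  rw [fits_iff I g hq, ← le_div_iff₀ hT0]
  exact (Nat.cast_le.2 h2).trans (Nat.floor_le (zero_le))

/-- If all players obtain enough, then the reduced instance has a good solution. -/
theorem exists_reduction_assignment {q : ℕ} (hq : 0 < q) (hT0 : 0 < guessValue q I g)
    (σ : I.Assignment) (hload : ∀ i, guessValue q I g ≤ I.load σ i) :
    ∃ τ : Fin (redJobs q I).length → Fin (redMachines q I).length, ∀ a,
      ∑ b with τ b = a, redSize q I g (redMachines q I)[a] (redJobs q I)[b] ≤
        scaledTarget q I.n.size := by
  classical
  set N := scaledTarget q I.n.size with hN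
  choose R hR hRi F hF hFinj using fun i => exists_player_config I g hq hT0 σ i (hload i)
  let jb : Fin (redJobs q I).length → ℕ × ℕ × ℕ := fun b => (redJobs q I)[b]
  have hjb : ∀ b, jb b ∈ redJobs q I := fun b => List.getElem_mem b.2
  let pl : Fin (redJobs q I).length → Fin I.m := fun b => ⟨(jb b).2.1, (mem_redJobs q I (hjb b)).1⟩
  -- Selectors go to the slot `R` chosen for their player, the entries of that slot to the resources
  -- given by `F`, and all other entries to their own slot, whose number is the tag minus one.
  let t : Fin (redJobs q I).length → ℕ := fun b =>
    if (jb b).1 = 0 then I.n + R (pl b)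
    else if (jb b).1 = R (pl b) + 1 then F (pl b) b else I.n + ((jb b).1 - 1)
  have ht : ∀ b, t b < (redMachines q I).length := by
    intro b
    rw [redMachines_length]
    simp only [t]
    split_ifs with h1 h2
    · have := hR (pl b); omega
    · obtain ⟨⟨h, -⟩, -⟩ := hF (pl b) b h2; omega
    · obtain ⟨-, h | ⟨r, hr, h, -⟩⟩ := mem_redJobs q I (hjb b) <;> omega
  -- jobs with a positive tag belong to a configuration
  have htag : ∀ b r, (jb b).1 = r + 1 → r < (slots q I).length ∧ (jb b).2.1 = (slot q I r).1 := by
    intro b r hb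
    obtain ⟨-, h | ⟨r', hr, h, h', -⟩⟩ := mem_redJobs q I (hjb b)
    · omega
    · have : r' = r := by omega
      subst this
      exact ⟨hr, h'⟩
  have hsel : ∀ b b', (jb b).1 = 0 → (jb b').1 = 0 → pl b = pl b' → b = b' := by
    intro b b' h h' hp
    refine Fin.ext ?_
    rw [redJobs_eq_selector q I b.2 h, redJobs_eq_selector q I b'.2 h']
    exact congrArg Fin.val hp
  refine ⟨fun b => ⟨t b, ht b⟩, fun a => ?_⟩
  have hta : ∀ b, (⟨t b, ht b⟩ : Fin (redMachines q I).length) = a ↔ t b = a := fun b =>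
    ⟨fun h => congrArg Fin.val h, fun h => Fin.ext h⟩
  simp only [hta]
  have hone : ∀ (s : Finset (Fin (redJobs q I).length)),
      (∀ b ∈ s, ∀ b' ∈ s, b = b') →
      (∀ b ∈ s, redSize q I g (redMachines q I)[a] (redJobs q I)[b] ≤ N) →
      ∑ b ∈ s, redSize q I g (redMachines q I)[a] (redJobs q I)[b] ≤ N := by
    intro s h1 h2
    refine (Finset.sum_le_card_nsmul _ _ _ h2).trans ?_
    have := Finset.card_le_one.2 h1
    rw [smul_eq_mul]
    nlinarith
  rcases lt_or_ge (a : ℕ) I.n with ha | ha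
  · -- a resource
    have hmc : (redMachines q I)[a] = (true, (a : ℕ), 0) := (redMachines_getElem_resource q I ha).2
    have hb : ∀ b, t b = a → (jb b).1 = R (pl b) + 1 ∧ F (pl b) b = a := by
      intro b hb
      simp only [t] at hb
      split_ifs at hb with h1 h2
      · omega
      · exact ⟨h2, hb⟩
      · omega
    refine hone _ (fun b hb1 b' hb2 => ?_) fun b hb1 => ?_
    · rw [Finset.mem_filter] at hb1 hb2
      obtain ⟨h1, h2⟩ := hb b hb1.2
      obtain ⟨h3, h4⟩ := hb b' hb2.2
      obtain ⟨⟨h5, h6⟩, -⟩ := hF (pl b) b h1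
      obtain ⟨⟨h7, h8⟩, -⟩ := hF (pl b') b' h3
      have h9 : pl b = pl b' := by
        rw [← h6, ← h8]
        congr 1
        exact Fin.ext (h2.trans h4.symm)
      refine hFinj (pl b) h1 (h9 ▸ h3 : (jb b').1 = R (pl b) + 1) ?_
      rw [h2]
      rw [← h9] at h4
      exact h4.symm
    · rw [Finset.mem_filter] at hb1
      obtain ⟨h1, h2⟩ := hb b hb1.2
      have h3 := (hF (pl b) b h1).2
      rw [h2] at h3
      rw [hmc, redSize]
      simp only [cond_true]
      have h4 : fits q I g a ((redJobs q I)[b]).2.1 ((redJobs q I)[b]).2.2 = true := h3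
      rw [h4, cond_true]
  · obtain ⟨r, hr⟩ := Nat.exists_eq_add_of_le ha
    have hrl : r < (slots q I).length := by
      have h1 := a.2
      have h2 := redMachines_length q I
      omega
    have hmc : (redMachines q I)[a] = (false, r + 1, (slot q I r).1) := by
      rw [← (redMachines_getElem_slot q I hrl).2]
      simp only [Fin.getElem_fin, hr]
    have hb : ∀ b, t b = a → (jb b).1 = 0 ∧ R (pl b) = r ∨
        (jb b).1 = r + 1 ∧ R (pl b) ≠ r := by
      intro b hb
      simp only [t] at hb
      split_ifs at hb with h1 h2
      · exact .inl ⟨h1, by omega⟩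
      · obtain ⟨⟨h, -⟩, -⟩ := hF (pl b) b h2; omega
      · exact .inr ⟨by omega, by omega⟩
    have hsize : ∀ b, t b = a →
        redSize q I g (redMachines q I)[a] (redJobs q I)[b] = (jb b).2.2 := by
      intro b hb1
      rw [hmc, redSize]
      simp only [cond_false]
      rw [if_pos]
      rcases hb b hb1 with ⟨h1, h2⟩ | ⟨h1, h2⟩
      · refine ⟨?_, .inr h1⟩
        have := hRi (pl b)
        rw [h2] at this
        exact this.symm
      · exact ⟨(htag b r h1).2, .inl h1⟩
    -- A chosen slot carries only the selector of its player. Any other slot carries only entries of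
    -- its own configuration, whose sum is at most `N`.
    by_cases hsel' : ∃ i, R i = r
    · obtain ⟨i, hi⟩ := hsel'
      have hb0 : ∀ b, t b = a → (jb b).1 = 0 ∧ pl b = i := by
        intro b hb1
        rcases hb b hb1 with ⟨h1, h2⟩ | ⟨h1, h2⟩
        · refine ⟨h1, Fin.ext ?_⟩
          have h3 := hRi (pl b)
          rw [h2, ← hi, hRi] at h3
          exact h3.symm
        · exfalso
          apply h2
          have h3 : pl b = i := by
            refine Fin.ext ?_
            have h4 := (htag b r h1).2
            rw [← hi, hRi] at h4
            exact h4
          rw [h3, hi]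
      refine hone _ (fun b hb1 b' hb2 => ?_) fun b hb1 => ?_
      · rw [Finset.mem_filter] at hb1 hb2
        obtain ⟨h1, h2⟩ := hb0 b hb1.2
        obtain ⟨h3, h4⟩ := hb0 b' hb2.2
        exact hsel b b' h1 h3 (h2.trans h4.symm)
      · rw [Finset.mem_filter] at hb1
        rw [hsize b hb1.2]
        obtain ⟨-, h | ⟨r', -, h, -⟩⟩ := mem_redJobs q I (hjb b)
        · exact h.2.le
        · have := (hb0 b hb1.2).1
          omega
    · have h1 : ∑ b with t b = a, redSize q I g (redMachines q I)[a] (redJobs q I)[b] =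
          ∑ b with t b = a, (jb b).2.2 :=
        Finset.sum_congr rfl fun b hb1 => hsize b (Finset.mem_filter.1 hb1).2
      rw [h1]
      refine (Finset.sum_le_sum_of_subset (t := Finset.univ.filter fun b => (jb b).1 = r + 1)
        fun b hb1 => ?_).trans ?_
      · rw [Finset.mem_filter] at hb1 ⊢
        refine ⟨Finset.mem_univ _, ?_⟩
        rcases hb b hb1.2 with ⟨h1, h2⟩ | ⟨h1, h2⟩
        · exact (hsel' ⟨_, h2⟩).elim
        · exact h1
      · refine (sum_redJobs q I hrl).trans_le ?_
        rcases slot_eq_or q I hrl with h | ⟨-, h⟩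
        · rw [h]; simp
        · rw [configs, List.mem_filter, decide_eq_true_iff] at h
          exact h.2.1

theorem optMakespan_reduction_le {q : ℕ} (hq : 0 < q) (hT0 : 0 < guessValue q I g)
    (hT : guessValue q I g ≤ I.optSantaClaus) :
    (reduction q I g).optMakespan ≤ scaledTarget q I.n.size := by
  obtain ⟨σ, -, hσ⟩ := Finset.exists_mem_eq_sup' Finset.univ_nonempty I.minValue
  obtain ⟨τ, hτ⟩ := exists_reduction_assignment I g hq hT0 σ fun i =>
    (hT.trans hσ.le).trans (Finset.inf'_le _ (Finset.mem_univ i))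
  have h1 : (reduction q I g).optMakespan ≤ (reduction q I g).makespan τ :=
    Finset.inf'_le _ (Finset.mem_univ _)
  exact h1.trans (reduction_makespan_le q I g τ hτ)

end

/-! ## The best candidate -/

/-- The predicate `P` marks the data on which the comparison program is faithful, such as fractions
with positive denominator. Maxima are covered through the dual order. -/
theorem foldl_select_spec {A κ : Type} [LinearOrder κ] (key : A → κ) (c : A → A → Bool)
    (P : A → Prop) (hc : ∀ a b, P a → P b → (c a b = true ↔ key b ≤ key a)) (l : List A) (b : A)
    (hb : P b) (hl : ∀ a ∈ l, P a) :
    let r := l.foldl (fun acc a => bif c acc a then a else acc) b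
    (r = b ∨ r ∈ l) ∧ key r ≤ key b ∧ ∀ a ∈ l, key r ≤ key a := by
  induction l generalizing b with
  | nil => simp
  | cons a l ih =>
    have ha := hl a List.mem_cons_self
    have hl' : ∀ x ∈ l, P x := fun x hx => hl x (List.mem_cons_of_mem _ hx)
    have hca := hc b a hb ha
    simp only [List.foldl_cons]
    cases h : c b a with
    | true =>
      obtain ⟨h1, h2, h3⟩ := ih a ha hl'
      simp only [h, cond_true, List.mem_cons, true_iff] at *
      refine ⟨.inr h1, h2.trans hca, ?_⟩
      rintro x (rfl | hx)
      exacts [h2, h3 x hx]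
    | false =>
      obtain ⟨h1, h2, h3⟩ := ih b hb hl'
      simp only [h, cond_false, List.mem_cons, Bool.false_eq_true, false_iff, not_le] at *
      refine ⟨h1.imp_right .inr, h2, ?_⟩
      rintro x (rfl | hx)
      exacts [h2.trans hca.le, h3 x hx]

section
variable (I : AllocInstance)

theorem loadFrac_spec (s : List ℕ) (i : ℕ) : 0 < (loadFrac I s i).2 ∧
    fracVal (loadFrac I s i) =
      ∑ j ∈ Finset.range I.n with s.getD j 0 = i, fracVal (I.entry i j) := by
  rw [loadFrac]
  generalize I.n = n
  induction n with
  | zero => simp [fracVal]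
  | succ n ih =>
    rw [List.range_succ, List.foldl_append, Finset.range_add_one, Finset.filter_insert]
    simp only [List.foldl_cons, List.foldl_nil]
    split_ifs with h
    · rw [Finset.sum_insert (by simp), fracVal_addFrac ih.1 (I.entry_snd_pos _ _), ih.2, add_comm]
      exact ⟨Nat.mul_pos ih.1 (I.entry_snd_pos _ _), rfl⟩
    · exact ih

theorem fracVal_loadFrac (σ : I.Assignment) (i : Fin I.m) :
    fracVal (loadFrac I (List.ofFn fun j => (σ j : ℕ)) i) = I.load σ i := by
  rw [(loadFrac_spec I _ _).2, I.load_eq σ i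
    (s := fun j => (List.ofFn fun j => (σ j : ℕ)).getD j 0)]
  intro j
  rw [List.getD_eq_getElem _ _ (by simp)]
  simp

theorem minFrac_spec (σ : I.Assignment) : 0 < (minFrac I (List.ofFn fun j => (σ j : ℕ))).2 ∧
    fracVal (minFrac I (List.ofFn fun j => (σ j : ℕ))) = I.minValue σ := by
  set s := List.ofFn fun j => (σ j : ℕ) with hs
  obtain ⟨h1, h2, h3⟩ := foldl_select_spec fracVal (fun acc a => leFrac a acc) (fun a => 0 < a.2)
    (fun a b ha hb => leFrac_iff hb ha) ((List.range I.m).map (loadFrac I s)) (loadFrac I s 0)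
    (loadFrac_spec I s 0).1 (by
      intro a ha
      obtain ⟨i, -, rfl⟩ := List.mem_map.1 ha
      exact (loadFrac_spec I s i).1)
  rw [← minFrac] at h1 h2 h3
  have h4 : ∃ i : Fin I.m, minFrac I s = loadFrac I s i := by
    rcases h1 with h | h
    · exact ⟨⟨0, I.m_pos⟩, h⟩
    · obtain ⟨i, hi, h⟩ := List.mem_map.1 h
      exact ⟨⟨i, List.mem_range.1 hi⟩, h.symm⟩
  obtain ⟨i, hi⟩ := h4
  refine ⟨hi ▸ (loadFrac_spec I s i).1, le_antisymm ?_ ?_⟩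
  · refine Finset.le_inf' _ _ fun i' _ => ?_
    rw [← fracVal_loadFrac]
    exact h3 _ (List.mem_map.2 ⟨i', List.mem_range.2 i'.2, rfl⟩)
  · rw [hi, fracVal_loadFrac]
    exact Finset.inf'_le _ (Finset.mem_univ i)

/-- The assignment that results from a guess. -/
def candidateAssignment (q : ℕ) (A : AllocInstance → List ℕ) (g : ℕ × ℕ × ℕ) : I.Assignment :=
  fun j => ⟨owner q I (A (reduction q I g)) j, owner_lt q I _ _⟩

theorem candidate_eq (q : ℕ) (A : AllocInstance → List ℕ) (g : ℕ × ℕ × ℕ) :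
    candidate q A I g = List.ofFn fun j => (candidateAssignment I q A g j : ℕ) :=
  List.ext_getElem (by simp [candidate]) (by simp [candidate, candidateAssignment])

theorem bestCandidate_spec (q : ℕ) (A : AllocInstance → List ℕ) : ∃ σ : I.Assignment,
    bestCandidate q A I = (List.ofFn fun j => (σ j : ℕ)) ∧
      ∀ g ∈ guesses q I, I.minValue (candidateAssignment I q A g) ≤ I.minValue σ := by
  have hdef : List.replicate I.n 0 = List.ofFn fun j =>
      (((fun _ => ⟨0, I.m_pos⟩ : I.Assignment) j : Fin I.m) : ℕ) :=
    List.ext_getElem (by simp) (by simp)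
  have hcand : ∀ a ∈ (guesses q I).map (candidate q A I),
      ∃ σ : I.Assignment, a = List.ofFn fun j => (σ j : ℕ) := by
    intro a ha
    obtain ⟨g, -, rfl⟩ := List.mem_map.1 ha
    exact ⟨_, candidate_eq I q A g⟩
  obtain ⟨h1, -, h3⟩ := foldl_select_spec (fun s => OrderDual.toDual (fracVal (minFrac I s)))
    (fun acc s => leFrac (minFrac I acc) (minFrac I s))
    (fun s => ∃ σ : I.Assignment, s = List.ofFn fun j => (σ j : ℕ))
    (by
      rintro _ _ ⟨σ, rfl⟩ ⟨σ', rfl⟩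
      rw [leFrac_iff (minFrac_spec I σ).1 (minFrac_spec I σ').1, OrderDual.toDual_le_toDual])
    ((guesses q I).map (candidate q A I)) (List.replicate I.n 0) ⟨_, hdef⟩ hcand
  rw [← bestCandidate] at h1 h3
  have h4 : ∃ σ : I.Assignment, bestCandidate q A I = List.ofFn fun j => (σ j : ℕ) := by
    rcases h1 with h | h
    · exact ⟨_, h.trans hdef⟩
    · exact hcand _ h
  obtain ⟨σ, hσ⟩ := h4
  refine ⟨σ, hσ, fun g hg => ?_⟩
  have h5 := h3 _ (List.mem_map.2 ⟨g, hg, rfl⟩)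
  rw [OrderDual.toDual_le_toDual, hσ, candidate_eq, (minFrac_spec I _).2,
    (minFrac_spec I _).2] at h5
  exact h5

/-- In an optimal assignment the worst-off player receives exactly the optimum, from at most `n`
resources. One of them is worth between `OPT / n` and `OPT`, so multiples of the `q`-th part of its
value approximate `OPT` with a polynomial number of candidates. -/
theorem exists_guess {q : ℕ} (hq : 0 < q) (hopt : 0 < I.optSantaClaus) : ∃ g ∈ guesses q I,
    0 < guessValue q I g ∧ guessValue q I g ≤ I.optSantaClaus ∧
      I.optSantaClaus * q ≤ guessValue q I g * (q + 1) := by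
  obtain ⟨σ, -, hσ⟩ := Finset.exists_mem_eq_sup' Finset.univ_nonempty I.minValue
  obtain ⟨i, -, hi⟩ := Finset.exists_mem_eq_inf' Finset.univ_nonempty (I.load σ)
  have hO : I.optSantaClaus = ∑ j with σ j = i, I.w i j := hσ.trans hi
  set O := I.optSantaClaus
  have hq0 : (0 : ℚ≥0) < q := by exact_mod_cast hq
  obtain ⟨j, hj, hjn⟩ : ∃ j, σ j = i ∧ O ≤ I.w i j * I.n := by
    by_contra! hcon
    have hne : (Finset.univ.filter fun j => σ j = i).Nonempty := by
      rw [Finset.nonempty_iff_ne_empty]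
      intro h
      rw [h, Finset.sum_empty] at hO
      exact hopt.ne' hO
    have h1 : ∑ j with σ j = i, I.w i j * I.n < ∑ j with σ j = i, O :=
      Finset.sum_lt_sum_of_nonempty hne fun j hj => hcon j (Finset.mem_filter.1 hj).2
    rw [← Finset.sum_mul, ← hO, Finset.sum_const, nsmul_eq_mul] at h1
    have h2 : (((Finset.univ.filter fun j => σ j = i).card : ℕ) : ℚ≥0) ≤ I.n := by
      exact_mod_cast (Finset.card_filter_le _ _).trans (by simp)
    have h3 := mul_le_mul_of_nonneg_right h2 hopt.le
    rw [mul_comm O] at h1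
    exact absurd h1 (not_lt.2 h3)
  have hw : 0 < I.w i j := by
    rcases eq_or_lt_of_le (zero_le (a := I.w i j)) with h | h
    · rw [← h, zero_mul] at hjn
      exact absurd hopt (not_lt.2 hjn)
    · exact h
  have hwO : I.w i j ≤ O := by
    rw [hO]
    exact Finset.single_le_sum (f := fun j => I.w i j) (fun _ _ => zero_le) (by simp [hj])
  set k := ⌊q * O / I.w i j⌋₊ with hk
  have hk1 : (k : ℚ≥0) ≤ q * O / I.w i j := Nat.floor_le zero_le
  have hk2 : q * O / I.w i j < k + 1 := Nat.lt_floor_add_one _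
  rw [le_div_iff₀ hw] at hk1
  rw [div_lt_iff₀ hw] at hk2
  -- Since the multiplier is at least `q`, rounding it down costs at most the factor `(q + 1) / q`.
  have hqk : q ≤ k := Nat.le_floor (by rw [le_div_iff₀ hw]; gcongr)
  have hkn : k ≤ q * I.n := by
    have h1 : (k : ℚ≥0) * I.w i j ≤ (q * I.n : ℕ) * I.w i j := by
      refine hk1.trans ?_
      push_cast
      rw [mul_assoc, mul_comm (I.n : ℚ≥0)]
      gcongr
    have h2 := le_of_mul_le_mul_right h1 hw
    exact_mod_cast h2
  have hT : guessValue q I ((i : ℕ), (j : ℕ), k) = I.w i j * k / q := by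
    rw [guessValue, I.fracVal_entry]
  refine ⟨((i : ℕ), (j : ℕ), k), ?_, ?_, ?_, ?_⟩
  · rw [guesses, List.mem_flatMap]
    refine ⟨i, List.mem_range.2 i.2, List.mem_flatMap.2 ⟨j, List.mem_range.2 j.2,
      List.mem_map.2 ⟨k, List.mem_range.2 (by omega), rfl⟩⟩⟩
  · rw [hT]
    have : (0 : ℚ≥0) < k := by exact_mod_cast hq.trans_le hqk
    positivity
  · rw [hT, div_le_iff₀ hq0]
    rw [mul_comm, mul_comm O]
    exact hk1
  · rw [hT, div_mul_eq_mul_div, le_div_iff₀ hq0]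
    have h1 : (q : ℚ≥0) ≤ k := by exact_mod_cast hqk
    calc O * q * q = (q * O) * q := by ring
      _ ≤ ((k + 1) * I.w i j) * q := by gcongr
      _ = I.w i j * (k * q + q) := by ring
      _ ≤ I.w i j * (k * q + k) := by gcongr
      _ = _ := by ring

end

/-! ### From programs to functions and back; the main theorem -/

theorem AllocInstance.enc_ofFn (I : AllocInstance) (σ : I.Assignment) :
    enc (List.ofFn fun j => (σ j : ℕ)) = I.encodeAssignment σ := by
  simp only [enc, encodeAssignment, List.map_ofFn, Function.comp_def]

/-- The values of the deterministic algorithm, as a function. -/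
theorem TreeProgram.FindsInPolyTime.exists_polyTime {p : TreeProgram}
    {good : (I : AllocInstance) → I.Assignment → Prop} (h : p.FindsInPolyTime good) :
    ∃ A : AllocInstance → List ℕ, PolyTime A ∧
      ∀ I, ∃ σ : I.Assignment, A I = (List.ofFn fun j => (σ j : ℕ)) ∧ good I σ := by
  obtain ⟨P, hP⟩ := h
  choose σ t h1 h2 h3 using hP
  refine ⟨fun I => List.ofFn fun j => (σ I j : ℕ), ⟨p, P, fun I => ⟨t I, ?_, h2 I⟩⟩,
    fun I => ⟨σ I, rfl, h3 I⟩⟩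
  rw [I.enc_ofFn]
  exact h1 I

theorem PolyTime.exists_findsInPolyTime {F : AllocInstance → List ℕ} (hF : PolyTime F)
    {good : (I : AllocInstance) → I.Assignment → Prop}
    (h : ∀ I, ∃ σ : I.Assignment, F I = (List.ofFn fun j => (σ j : ℕ)) ∧ good I σ) :
    ∃ p : TreeProgram, p.FindsInPolyTime good := by
  obtain ⟨p, P, hp⟩ := hF
  refine ⟨p, P, fun I => ?_⟩
  obtain ⟨t, h1, h2⟩ := hp I
  obtain ⟨σ, h3, h4⟩ := h I
  rw [h3, I.enc_ofFn] at h1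
  exact ⟨σ, t, h1, h2, h4⟩

theorem candidateAssignment_spec (I : AllocInstance) {q : ℕ} (hq : 0 < q) {α : ℝ} (hα : 2 ≤ α)
    {A : AllocInstance → List ℕ} (hA : ∀ J : AllocInstance, ∃ τ : J.Assignment,
      A J = (List.ofFn fun b => (τ b : ℕ)) ∧
        (J.makespan τ : ℝ) ≤ (2 - 1 / α) * (J.optMakespan : ℝ))
    {g : ℕ × ℕ × ℕ} (hT0 : 0 < guessValue q I g) (hT : guessValue q I g ≤ I.optSantaClaus) :
    (1 / α - 3 / q) * (guessValue q I g : ℝ) ≤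
      (I.minValue (candidateAssignment I q A g) : ℝ) := by
  obtain ⟨τ, h1, h2⟩ := hA (reduction q I g)
  have h3 : ((reduction q I g).optMakespan : ℝ) ≤ scaledTarget q I.n.size := by
    exact_mod_cast optMakespan_reduction_le I g hq hT0 hT
  have h4 : (0 : ℝ) ≤ 2 - 1 / α := by
    have : 1 / α ≤ 1 := by rw [div_le_one (by linarith)]; linarith
    linarith
  have h5 := h2.trans (mul_le_mul_of_nonneg_left h3 h4)
  obtain ⟨i, -, hi⟩ := Finset.exists_mem_eq_inf' Finset.univ_nonempty
    (I.load (candidateAssignment I q A g))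
  have h6 : I.minValue (candidateAssignment I q A g) = I.load (candidateAssignment I q A g) i := hi
  rw [h6]
  refine reduction_sound I g hq α hα τ h5 _ (fun j => ?_) i
  exact congrArg (fun s => owner q I s j) h1

theorem theorem1p1 (α : ℝ) (hα : 2 ≤ α)
    (h : ∃ p : TreeProgram, IsPolyTimeMakespanApprox (2 - 1 / α) p) :
    ∀ ε : ℝ, 0 < ε → ∃ q : TreeProgram, IsPolyTimeSantaClausApprox (α + ε) q := by
  intro ε hε
  obtain ⟨p, hp⟩ := h
  obtain ⟨A, hA, hA'⟩ := hp.exists_polyTime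
  have hδ : 0 < 1 / α - 1 / (α + ε) := by
    rw [sub_pos]
    exact one_div_lt_one_div_of_lt (by linarith) (by linarith)
  -- Of the constant 4, three units pay for the loss `3 / q` in the configurations and one for the
  -- factor `(q + 1) / q` of the guess, using `1 / (α + ε) ≤ 1`.
  obtain ⟨q, hqδ⟩ := exists_nat_gt (4 / (1 / α - 1 / (α + ε)))
  have hq0 : (0 : ℝ) < q := lt_trans (by positivity) hqδ
  have hq : 0 < q := by exact_mod_cast hq0
  rw [div_lt_iff₀ hδ] at hqδ
  refine (PolyTime.bestCandidate q hA).exists_findsInPolyTime fun I => ?_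
  obtain ⟨σ, h1, h2⟩ := bestCandidate_spec I q A
  refine ⟨σ, h1, ?_⟩
  -- If the optimum is zero, any assignment suffices, and there is no positive guess below it.
  rcases eq_or_lt_of_le (zero_le (a := I.optSantaClaus)) with h0 | h0
  · rw [← h0]
    simp only [NNRat.cast_zero, zero_div]
    exact_mod_cast zero_le
  obtain ⟨g, hg, hT0, hT, hTO⟩ := exists_guess I hq h0
  have h3 := candidateAssignment_spec I hq hα hA' hT0 hT
  have h4 : (I.minValue (candidateAssignment I q A g) : ℝ) ≤ (I.minValue σ : ℝ) := by
    exact_mod_cast h2 g hg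
  refine le_trans ?_ (h3.trans h4)
  have h5 : (I.optSantaClaus : ℝ) * q ≤ (guessValue q I g : ℝ) * (q + 1) := by
    exact_mod_cast hTO
  have h6 : (0 : ℝ) ≤ I.optSantaClaus := by exact_mod_cast h0.le
  have hβ : 1 / (α + ε) ≤ 1 := by
    rw [div_le_one (by linarith)]; linarith
  have h7 : (q + 1) * (1 / (α + ε)) ≤ q * (1 / α - 3 / q) := by
    have : q * (1 / α - 3 / q) = q * (1 / α) - 3 := by field_simp
    rw [this]
    linarith
  have h8 : 0 ≤ 1 / α - 3 / (q : ℝ) := by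
    have h9 : 0 < q * (1 / α - 3 / (q : ℝ)) := lt_of_lt_of_le (by positivity) h7
    exact (pos_of_mul_pos_right h9 hq0.le).le
  have h9 : (q + 1) * ((I.optSantaClaus : ℝ) / (α + ε)) ≤
      (q + 1) * ((1 / α - 3 / q) * (guessValue q I g : ℝ)) := by
    calc (q + 1) * ((I.optSantaClaus : ℝ) / (α + ε))
        = ((q + 1) * (1 / (α + ε))) * I.optSantaClaus := by ring
      _ ≤ (q * (1 / α - 3 / q)) * I.optSantaClaus := mul_le_mul_of_nonneg_right h7 h6
      _ = (1 / α - 3 / q) * (I.optSantaClaus * q) := by ring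
      _ ≤ (1 / α - 3 / q) * ((guessValue q I g : ℝ) * (q + 1)) :=
          mul_le_mul_of_nonneg_left h5 h8
      _ = _ := by ring
  exact le_of_mul_le_mul_left h9 (by positivity)
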